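/- Let $d\ge 1$, $s\ge 0$, and for functions on $\mathbb{R}^d$ let $\hat g(\xi)=(2\pi)^{-d}\int_{\mathbb{R}^d} g(x)e^{-ix\cdot\xi}\,dx$ denote the Fourier transform, extended to tempered distributions. The spectral Barron space $\mathcal{B}^s(\mathbb{R}^d)$ consists of the functions $g:\mathbb{R}^d\to\mathbb{R}$ (modulo almost everywhere equality) whose Fourier transform $\hat g$ is a function with $$\|g\|_{\mathcal{B}^s(\mathbb{R}^d)}:=\int_{\mathbb{R}^d}|\hat g(\xi)|\,(1+|\xi|^2)^{s/2}\,d\xi<\infty .$$ Let $V:\mathbb{R}^d\to\mathbb{R}$ satisfy $V(x)\ge 0$ for all $x\in\mathbb{R}^d$ and $V=\alpha+W$ (almost everywhere), where $\alpha>0$ is a constant and $W\in\mathcal{B}^s(\mathbb{R}^d)$. For $u\in\mathcal{B}^s(\mathbb{R}^d)$ let $\mathcal{T}_{\alpha,W}u=(\alpha-\Delta)^{-1}(Wu)$, that is, the function $v$ that defines a tempered distribution and solves $\alpha v-\Delta v=Wu$ in the sense of tempered distributions. Then $\mathcal{T}_{\alpha,W}$ is a well-defined bounded linear operator $\mathcal{B}^s(\mathbb{R}^d)\to\mathcal{B}^s(\mathbb{R}^d)$,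 and $I+\mathcal{T}_{\alpha,W}$ has a two-sided inverse $$(I+\mathcal{T}_{\alpha,W})^{-1}:\mathcal{B}^s(\mathbb{R}^d)\to\mathcal{B}^s(\mathbb{R}^d)$$ which is a bounded linear operator. -/

import Mathlib

open MeasureTheory
open scoped SchwartzMap FourierTransform

noncomputable section

namespace Barron

/-- The Euclidean space `ℝ^d`. -/
abbrev Rd (d : ℕ) : Type := EuclideanSpace ℝ (Fin d)

/-- Real-valued (Lebesgue measurable) functions on `ℝ^d`, up to almost everywhere equality. -/
abbrev Fn (d : ℕ) : Type := Rd d →ₘ[(volume : Measure (Rd d))] ℝ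

/-- The Fourier transform `φ̂(ξ) = (2π)^{-d} ∫ φ(x) e^{-i x·ξ} dx` of a Schwartz function. -/
def schwartzHat {d : ℕ} (φ : 𝓢(Rd d, ℂ)) (ξ : Rd d) : ℂ :=
  (((2 * Real.pi) ^ d)⁻¹ : ℝ) *
    ∫ x, φ x * Complex.exp (-(Complex.I * ((inner ℝ x ξ : ℝ) : ℂ)))

/-- `g` defines a tempered distribution `φ ↦ ∫ g φ` (absolutely convergent integrals). -/
def IsTempered {d : ℕ} (g : Rd d → ℂ) : Prop :=
  ∀ φ : 𝓢(Rd d, ℂ), Integrable (fun x => g x * φ x)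

/-- The distributional Fourier transform of the function `g` is the function `h`:
both define tempered distributions, and `⟨h, φ⟩ = ⟨g, φ̂⟩` for all Schwartz `φ`. -/
structure HasFourier {d : ℕ} (g : Fn d) (h : Rd d → ℂ) : Prop where
  tempered_left : IsTempered (fun x => ((g x : ℝ) : ℂ))
  tempered_right : IsTempered h
  eq : ∀ φ : 𝓢(Rd d, ℂ), ∫ x, ((g x : ℝ) : ℂ) * schwartzHat φ x = ∫ ξ, h ξ * φ ξ

/-- The weight `(1 + |ξ|²)^{s/2}`. -/
def weight {d : ℕ} (s : ℝ) (ξ : Rd d) : ℝ := (1 + ‖ξ‖ ^ 2) ^ (s / 2)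

open Classical in
/-- The Fourier transform `ĝ` of a function `g` whose distributional Fourier transform is a
function (it is unique almost everywhere, see `HasFourier.ae_unique`); zero otherwise. -/
def hat {d : ℕ} (g : Fn d) : Rd d → ℂ :=
  if h : ∃ k, HasFourier g k then h.choose else 0

/-- Membership in the spectral Barron space: the Fourier transform of `g` is a function `h`
with `∫ |h(ξ)| (1 + |ξ|²)^{s/2} dξ < ∞`. -/
def MemBarron {d : ℕ} (s : ℝ) (g : Fn d) : Prop :=
  ∃ h, HasFourier g h ∧ Integrable (fun ξ => ‖h ξ‖ * weight s ξ)

section Facts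

variable {d : ℕ}

/-- The transform of a Schwartz function is Mathlib's one, rescaled. -/
theorem schwartzHat_eq (φ : 𝓢(Rd d, ℂ)) (ξ : Rd d) :
    schwartzHat φ ξ
      = (((2 * Real.pi) ^ d)⁻¹ : ℝ) * (𝓕 φ) ((2 * Real.pi)⁻¹ • ξ) := by
  rw [schwartzHat, SchwartzMap.fourier_coe, Real.fourier_eq']
  congr 2
  ext x
  rw [smul_eq_mul, mul_comm, real_inner_smul_right]
  congr 2
  have : (Real.pi : ℂ) ≠ 0 := by exact_mod_cast Real.pi_ne_zero
  push_cast
  field_simp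

/-- The dilation `ξ ↦ c ξ` as a continuous linear equivalence. -/
def dil (c : ℝ) (hc : c ≠ 0) : Rd d ≃L[ℝ] Rd d :=
  ContinuousLinearEquiv.smulLeft (Units.mk0 c hc)

theorem two_pi_inv_ne : ((2 * Real.pi)⁻¹ : ℝ) ≠ 0 := by positivity

theorem exists_schwartz_eq_hat (φ : 𝓢(Rd d, ℂ)) :
    ∃ ψ : 𝓢(Rd d, ℂ), ∀ ξ, ψ ξ = schwartzHat φ ξ := by
  refine ⟨((((2 * Real.pi) ^ d)⁻¹ : ℝ) : ℂ) •
    SchwartzMap.compCLMOfContinuousLinearEquiv ℂ (dil _ two_pi_inv_ne) (𝓕 φ), fun ξ => ?_⟩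
  rw [schwartzHat_eq]
  rfl

theorem exists_hat_eq_schwartz (ψ : 𝓢(Rd d, ℂ)) :
    ∃ φ : 𝓢(Rd d, ℂ), ∀ ξ, schwartzHat φ ξ = ψ ξ := by
  have h2 : (2 * Real.pi : ℝ) ≠ 0 := by positivity
  refine ⟨𝓕⁻ ((((2 * Real.pi) ^ d : ℝ) : ℂ) •
    SchwartzMap.compCLMOfContinuousLinearEquiv ℂ (dil _ h2) ψ), fun ξ => ?_⟩
  rw [schwartzHat_eq, FourierTransform.fourier_fourierInv_eq]
  change _ * ((((2 * Real.pi) ^ d : ℝ) : ℂ) * ψ ((2 * Real.pi) • ((2 * Real.pi)⁻¹ • ξ))) = _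
  rw [smul_inv_smul₀ h2, ← mul_assoc, ← Complex.ofReal_mul,
    inv_mul_cancel₀ (pow_ne_zero _ h2), Complex.ofReal_one, one_mul]

theorem IsTempered.mul_hat {g : Rd d → ℂ} (hg : IsTempered g) (φ : 𝓢(Rd d, ℂ)) :
    Integrable (fun x => g x * schwartzHat φ x) := by
  obtain ⟨ψ, hψ⟩ := exists_schwartz_eq_hat φ
  simpa only [hψ] using hg ψ

/-- A compactly supported smooth real function as a complex Schwartz function. -/
theorem exists_schwartz_of_smooth (f : Rd d → ℝ) (hf : ContDiff ℝ (⊤ : ℕ∞) f)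
    (hc : HasCompactSupport f) : ∃ φ : 𝓢(Rd d, ℂ), ∀ x, φ x = (f x : ℂ) :=
  ⟨(hc.comp_left (g := fun r : ℝ => (r : ℂ)) Complex.ofReal_zero).toSchwartzMap
    (Complex.ofRealCLM.contDiff.comp hf), fun _ => rfl⟩

theorem IsTempered.locallyIntegrable {g : Rd d → ℂ} (hg : IsTempered g) :
    LocallyIntegrable g := by
  intro x
  let b : ContDiffBump x := ⟨1, 2, one_pos, one_lt_two⟩
  obtain ⟨φ, hφ⟩ := exists_schwartz_of_smooth b b.contDiff b.hasCompactSupport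
  refine ⟨Metric.closedBall x 1, Metric.closedBall_mem_nhds x one_pos, ?_⟩
  refine ((hg φ).integrableOn (s := Metric.closedBall x 1)).congr_fun (fun y hy => ?_)
    Metric.isClosed_closedBall.measurableSet
  simp only [hφ]
  rw [b.one_of_mem_closedBall hy]
  simp

/-- A function is determined by the tempered distribution it defines. -/
theorem IsTempered.ae_eq {g k : Rd d → ℂ} (hg : IsTempered g) (hk : IsTempered k)
    (h : ∀ φ : 𝓢(Rd d, ℂ), ∫ x, g x * φ x = ∫ x, k x * φ x) : g =ᵐ[volume] k := by
  refine ae_eq_of_integral_contDiff_smul_eq hg.locallyIntegrable hk.locallyIntegrable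
    fun f hf hc => ?_
  obtain ⟨φ, hφ⟩ := exists_schwartz_of_smooth f hf hc
  simpa only [hφ, Complex.real_smul, mul_comm] using h φ

theorem HasFourier.ae_unique {g : Fn d} {h k : Rd d → ℂ} (hh : HasFourier g h)
    (hk : HasFourier g k) : h =ᵐ[volume] k :=
  hh.tempered_right.ae_eq hk.tempered_right fun φ => by rw [← hh.eq, ← hk.eq]

theorem HasFourier.eq_zero {g : Fn d} {h : Rd d → ℂ} (hh : HasFourier g h)
    (h0 : h =ᵐ[volume] 0) : g = 0 := by
  have h1 : (fun x => ((g x : ℝ) : ℂ)) =ᵐ[volume] fun _ => 0 := by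
    refine hh.tempered_left.ae_eq (fun φ => by simp) fun ψ => ?_
    obtain ⟨φ, hφ⟩ := exists_hat_eq_schwartz ψ
    simp only [← hφ]
    rw [hh.eq, integral_congr_ae (g := fun _ => 0) (by filter_upwards [h0] with x hx; simp [hx])]
    simp
  refine AEEqFun.ext ?_
  filter_upwards [h1, AEEqFun.coeFn_zero (α := Rd d) (μ := volume) (β := ℝ)] with x hx h0
  rw [h0]
  exact_mod_cast hx

theorem HasFourier.zero : HasFourier (0 : Fn d) 0 := by
  have h0 := AEEqFun.coeFn_zero (α := Rd d) (μ := volume) (β := ℝ)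
  have key : ∀ f : Rd d → ℂ,
      (fun x => (((0 : Fn d) x : ℝ) : ℂ) * f x) =ᵐ[volume] fun _ => 0 := fun f => by
    filter_upwards [h0] with x hx
    simp [hx]
  refine ⟨fun φ => (integrable_congr (key φ)).2 (integrable_zero _ _ _), fun φ => by simp,
    fun φ => ?_⟩
  rw [integral_congr_ae (key _)]
  simp

theorem HasFourier.add {g g' : Fn d} {h h' : Rd d → ℂ} (H : HasFourier g h)
    (H' : HasFourier g' h') : HasFourier (g + g') (h + h') := by
  have key : ∀ f : Rd d → ℂ, (fun x => (((g + g') x : ℝ) : ℂ) * f x) =ᵐ[volume]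
      fun x => (g x : ℂ) * f x + (g' x : ℂ) * f x := fun f => by
    filter_upwards [AEEqFun.coeFn_add g g'] with x hx
    simp [hx, add_mul]
  refine ⟨fun φ => (integrable_congr (key φ)).2
    ((H.tempered_left φ).add (H'.tempered_left φ)), fun φ => ?_, fun φ => ?_⟩
  · refine ((H.tempered_right φ).add (H'.tempered_right φ)).congr
      (Filter.Eventually.of_forall fun x => ?_)
    simp only [Pi.add_apply, add_mul]
  · rw [integral_congr_ae (key _),
      integral_add (H.tempered_left.mul_hat φ) (H'.tempered_left.mul_hat φ), H.eq, H'.eq,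
      ← integral_add (H.tempered_right φ) (H'.tempered_right φ)]
    simp only [Pi.add_apply, add_mul]

theorem HasFourier.smul {g : Fn d} {h : Rd d → ℂ} (c : ℝ) (H : HasFourier g h) :
    HasFourier (c • g) ((c : ℂ) • h) := by
  have key : ∀ f : Rd d → ℂ, (fun x => (((c • g) x : ℝ) : ℂ) * f x) =ᵐ[volume]
      fun x => (c : ℂ) * ((g x : ℂ) * f x) := fun f => by
    filter_upwards [AEEqFun.coeFn_smul c g] with x hx
    simp [hx, mul_assoc]
  refine ⟨fun φ => (integrable_congr (key φ)).2 ((H.tempered_left φ).const_mul _),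
    fun φ => ?_, fun φ => ?_⟩
  · simpa only [Pi.smul_apply, smul_eq_mul, mul_assoc] using (H.tempered_right φ).const_mul _
  · rw [integral_congr_ae (key _), integral_const_mul, H.eq, ← integral_const_mul]
    simp only [Pi.smul_apply, smul_eq_mul, mul_assoc]

theorem weight_pos (s : ℝ) (ξ : Rd d) : 0 < weight s ξ :=
  Real.rpow_pos_of_pos (by positivity) _

theorem continuous_weight (s : ℝ) : Continuous (weight (d := d) s) := by
  unfold weight
  exact (by fun_prop : Continuous fun ξ : Rd d => 1 + ‖ξ‖ ^ 2).rpow_const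
    fun ξ => Or.inl (by positivity)

theorem HasFourier.aestronglyMeasurable {g : Fn d} {h : Rd d → ℂ} (H : HasFourier g h) :
    AEStronglyMeasurable h :=
  H.tempered_right.locallyIntegrable.aestronglyMeasurable

theorem integrable_add_weight {s : ℝ} {h h' : Rd d → ℂ}
    (m : AEStronglyMeasurable h) (m' : AEStronglyMeasurable h')
    (I : Integrable (fun ξ => ‖h ξ‖ * weight s ξ))
    (I' : Integrable (fun ξ => ‖h' ξ‖ * weight s ξ)) :
    Integrable (fun ξ => ‖(h + h') ξ‖ * weight s ξ) := by
  refine (I.add I').mono'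
    ((m.add m').norm.mul (continuous_weight s).aestronglyMeasurable) ?_
  refine Filter.Eventually.of_forall fun ξ => ?_
  have hw := (weight_pos s ξ).le
  rw [Real.norm_of_nonneg (by positivity)]
  simp only [Pi.add_apply, ← add_mul]
  exact mul_le_mul_of_nonneg_right (norm_add_le _ _) hw

theorem MemBarron.zero (s : ℝ) : MemBarron s (0 : Fn d) := ⟨0, HasFourier.zero, by simp⟩

theorem MemBarron.add {s : ℝ} {g g' : Fn d} : MemBarron s g → MemBarron s g' →
    MemBarron s (g + g')
  | ⟨_, H, I⟩, ⟨_, H', I'⟩ => ⟨_, H.add H',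
      integrable_add_weight H.aestronglyMeasurable H'.aestronglyMeasurable I I'⟩

theorem MemBarron.smul {s : ℝ} (c : ℝ) {g : Fn d} : MemBarron s g → MemBarron s (c • g)
  | ⟨_, H, I⟩ => ⟨_, H.smul c, by
      simpa only [Pi.smul_apply, norm_smul, mul_assoc] using I.const_mul _⟩

end Facts

/-- The spectral Barron space as a linear subspace of the space of functions. -/
def barronSubmodule (d : ℕ) (s : ℝ) : Submodule ℝ (Fn d) where
  carrier := {g | MemBarron s g}
  zero_mem' := MemBarron.zero s
  add_mem' := MemBarron.add
  smul_mem' := fun c _ h => MemBarron.smul c h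

/-- The spectral Barron space `B^s(ℝ^d)`, normed below by the spectral Barron norm. -/
def BarronSpace (d : ℕ) (s : ℝ) : Type := barronSubmodule d s

namespace BarronSpace

variable {d : ℕ} {s : ℝ}

instance : AddCommGroup (BarronSpace d s) := inferInstanceAs (AddCommGroup (barronSubmodule d s))

instance : Module ℝ (BarronSpace d s) := inferInstanceAs (Module ℝ (barronSubmodule d s))

/-- The function underlying an element of the spectral Barron space. -/
def toFn (u : BarronSpace d s) : Fn d := Subtype.val u

theorem toFn_zero : (0 : BarronSpace d s).toFn = 0 := rfl

theorem toFn_add (u v : BarronSpace d s) : (u + v).toFn = u.toFn + v.toFn := rfl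

theorem toFn_smul (c : ℝ) (u : BarronSpace d s) : (c • u).toFn = c • u.toFn := rfl

theorem hasFourier_hat (u : BarronSpace d s) : HasFourier u.toFn (hat u.toFn) := by
  have h : ∃ k, HasFourier u.toFn k := u.2.imp fun _ h => h.1
  rw [hat, dif_pos h]
  exact h.choose_spec

theorem integrable_hat (u : BarronSpace d s) :
    Integrable (fun ξ => ‖hat u.toFn ξ‖ * weight s ξ) := by
  obtain ⟨k, hk, hi⟩ := u.2
  refine hi.congr ?_
  filter_upwards [hk.ae_unique u.hasFourier_hat] with ξ h
  rw [h]

/-- The spectral Barron norm `∫ |û(ξ)| (1 + |ξ|²)^{s/2} dξ`. -/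
instance : Norm (BarronSpace d s) := ⟨fun u => ∫ ξ, ‖hat u.toFn ξ‖ * weight s ξ⟩

theorem norm_def (u : BarronSpace d s) : ‖u‖ = ∫ ξ, ‖hat u.toFn ξ‖ * weight s ξ := rfl

theorem norm_eq {u : BarronSpace d s} {h : Rd d → ℂ} (H : HasFourier u.toFn h) :
    ‖u‖ = ∫ ξ, ‖h ξ‖ * weight s ξ := by
  refine integral_congr_ae ?_
  filter_upwards [u.hasFourier_hat.ae_unique H] with ξ h
  rw [h]

theorem normCore : NormedSpace.Core ℝ (BarronSpace d s) where
  norm_nonneg u := integral_nonneg fun ξ => mul_nonneg (norm_nonneg _) (weight_pos s ξ).le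
  norm_smul c u := by
    rw [norm_eq (u := c • u) (toFn_smul c u ▸ u.hasFourier_hat.smul c), norm_def,
      ← integral_const_mul]
    simp [mul_assoc]
  norm_triangle u v := by
    rw [norm_eq (u := u + v) (toFn_add u v ▸ u.hasFourier_hat.add v.hasFourier_hat), norm_def,
      norm_def, ← integral_add u.integrable_hat v.integrable_hat]
    refine integral_mono (integrable_add_weight u.hasFourier_hat.aestronglyMeasurable
      v.hasFourier_hat.aestronglyMeasurable u.integrable_hat v.integrable_hat)
      (u.integrable_hat.add v.integrable_hat) fun ξ => ?_
    simp only [Pi.add_apply, ← add_mul]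
    exact mul_le_mul_of_nonneg_right (norm_add_le _ _) (weight_pos s ξ).le
  norm_eq_zero_iff u := by
    constructor
    · intro h
      rw [norm_def, integral_eq_zero_iff_of_nonneg
        (fun ξ => mul_nonneg (norm_nonneg _) (weight_pos s ξ).le) u.integrable_hat] at h
      refine Subtype.ext (u.hasFourier_hat.eq_zero ?_)
      filter_upwards [h] with ξ hξ
      simpa [(weight_pos s ξ).ne'] using hξ
    · rintro rfl
      rw [norm_eq (u := 0) (h := 0) (toFn_zero (d := d) (s := s) ▸ HasFourier.zero)]
      simp

instance : NormedAddCommGroup (BarronSpace d s) := NormedAddCommGroup.ofCore normCore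

instance : NormedSpace ℝ (BarronSpace d s) := NormedSpace.ofCore normCore

end BarronSpace

/-- `α v - Δ v = g` in the sense of tempered distributions. -/
structure SolvesHelmholtz {d : ℕ} (α : ℝ) (g v : Fn d) : Prop where
  tempered_left : IsTempered (fun x => ((v x : ℝ) : ℂ))
  tempered_right : IsTempered (fun x => ((g x : ℝ) : ℂ))
  eq : ∀ φ : 𝓢(Rd d, ℂ),
    ∫ x, ((v x : ℝ) : ℂ) * ((α : ℂ) * φ x - Laplacian.laplacian φ x)
      = ∫ x, ((g x : ℝ) : ℂ) * φ x

open Classical in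
/-- `(α - Δ)^{-1} g`: for `α > 0`, the (unique) tempered function `v` with `α v - Δ v = g`;
zero if there is none. -/
def helmholtzInv {d : ℕ} (α : ℝ) (g : Fn d) : Fn d :=
  if h : ∃ v, SolvesHelmholtz α g v then h.choose else 0

/-- The operator `T_{α,W} u = (α - Δ)^{-1} (W u)`. -/
def schrodingerOp {d : ℕ} (α : ℝ) (W u : Fn d) : Fn d := helmholtzInv α (W * u)

end Barron

end

open MeasureTheory
open scoped SchwartzMap FourierTransform

noncomputable section

namespace Barron

open Filter Topology

variable {d : ℕ}

/-! The weighted transform `u ↦ weight s · û` identifies the Barron space isometrically with a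
closed real subspace `realSubmodule` of complex `L¹`. There `T` becomes an operator `A`: convolve
with `Ŵ` (reweighted), then multiply by `1/(α + |ξ|²)`. The theorem is the Fredholm alternative for
`1 + A`, so two facts are needed.

Compactness. `A H = ∫ H(η) Φ(η) dη` for a bounded continuous family `Φ` in `L¹`. Peetre's inequality
bounds the ratio of weights, and the decay of `1/(α + |ξ|²)` makes `Φ(η) → 0` as `η → ∞`. So `Φ` has
relatively compact range, and the image of the unit ball lies in the closed convex hull of a compact
set (`isCompactOperator_of_tendsto_zero`).

Injectivity. If `A f = -f`, the corresponding function `u` is continuous, tends to `0` at infinity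
by Riemann-Lebesgue, and satisfies `Δu = (α + W) u` with `α + W ≥ 0`. The maximum principle
`re_synth_nonpos`, applied to `u` and `-u`, gives `u = 0`. -/

/-! ### Fourier synthesis of integrable transforms. -/

/-- The inverse of the Fourier transform `hat`, on functions:
`h ↦ (x ↦ ∫ h(ξ) e^{i x·ξ} dξ)`. -/
def synth (h : Rd d → ℂ) (x : Rd d) : ℂ :=
  ∫ ξ, Complex.exp (Complex.I * ((inner ℝ x ξ : ℝ) : ℂ)) * h ξ

theorem norm_character (t : ℝ) : ‖Complex.exp (Complex.I * (t : ℂ))‖ = 1 :=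
  Complex.norm_exp_I_mul_ofReal t

theorem integrable_character_mul {h : Rd d → ℂ} (hh : Integrable h) (x : Rd d) :
    Integrable fun ξ => Complex.exp (Complex.I * ((inner ℝ x ξ : ℝ) : ℂ)) * h ξ := by
  refine hh.bdd_mul (c := 1) (Continuous.aestronglyMeasurable (by fun_prop)) ?_
  exact Eventually.of_forall fun ξ => (norm_character _).le

theorem synth_congr {h k : Rd d → ℂ} (e : h =ᵐ[volume] k) : synth h = synth k := by
  ext x
  refine integral_congr_ae ?_
  filter_upwards [e] with ξ hξ
  rw [hξ]

theorem synth_eq_fourierInv (h : Rd d → ℂ) (x : Rd d) :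
    synth h x = 𝓕⁻ h ((2 * Real.pi)⁻¹ • x) := by
  rw [synth, Real.fourierInv_eq']
  congr 1
  ext ξ
  rw [smul_eq_mul, real_inner_smul_right, real_inner_comm]
  congr 2
  have : (Real.pi : ℂ) ≠ 0 := by exact_mod_cast Real.pi_ne_zero
  push_cast
  field_simp

theorem norm_synth_le (h : Rd d → ℂ) (x : Rd d) : ‖synth h x‖ ≤ ∫ ξ, ‖h ξ‖ := by
  refine (norm_integral_le_integral_norm _).trans_eq ?_
  simp only [norm_mul, norm_character, one_mul]

theorem continuous_synth {h : Rd d → ℂ} (hh : Integrable h) : Continuous (synth h) := by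
  refine continuous_of_dominated
    (fun x => (integrable_character_mul hh x).aestronglyMeasurable)
    (fun x => Eventually.of_forall fun ξ => ?_) hh.norm
    (Eventually.of_forall fun ξ => by fun_prop)
  rw [norm_mul, norm_character, one_mul]

/-- The Riemann-Lebesgue lemma. -/
theorem tendsto_synth_cocompact (h : Rd d → ℂ) :
    Tendsto (synth h) (cocompact (Rd d)) (𝓝 0) := by
  have h0 := tendsto_integral_exp_inner_smul_cocompact h
  -- `fourierChar` carries a factor `2π` and the kernel on the right a minus sign, hence the
  -- dilation by `-(2π)⁻¹`.
  have e : synth h = (fun w : Rd d => ∫ v, Real.fourierChar (-(inner ℝ v w)) • h v) ∘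
      (dil (-(2 * Real.pi)⁻¹) (neg_ne_zero.2 two_pi_inv_ne)) := by
    ext x
    rw [synth_eq_fourierInv, Real.fourierInv_eq]
    simp only [Function.comp]
    congr 1
    ext v
    change _ = Real.fourierChar (-(inner ℝ v (-(2 * Real.pi)⁻¹ • x))) • h v
    rw [real_inner_smul_right, real_inner_smul_right]
    simp
  rw [e]
  exact h0.comp (dil (d := d) _ _).toHomeomorph.isClosedEmbedding.tendsto_cocompact

theorem synth_add {h k : Rd d → ℂ} (hh : Integrable h) (hk : Integrable k) (x : Rd d) :
    synth (fun ξ => h ξ + k ξ) x = synth h x + synth k x := by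
  simp only [synth, mul_add]
  exact integral_add (integrable_character_mul hh x) (integrable_character_mul hk x)

theorem synth_const_mul (c : ℂ) (h : Rd d → ℂ) (x : Rd d) :
    synth (fun ξ => c * h ξ) x = c * synth h x := by
  simp only [synth, mul_left_comm _ c]
  exact integral_const_mul _ _

theorem synth_conj_neg (h : Rd d → ℂ) (x : Rd d) :
    synth (fun ξ => starRingEnd ℂ (h (-ξ))) x = starRingEnd ℂ (synth h x) := by
  rw [synth, synth, ← integral_conj, ← integral_neg_eq_self]
  congr 1
  ext ξ
  simp [← Complex.exp_conj]

/-- Fubini, since the character `e^{i x·ξ}` is symmetric in `x` and `ξ`. -/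
theorem integral_synth_mul {h f : Rd d → ℂ} (hh : Integrable h) (hf : Integrable f) :
    ∫ x, synth h x * f x = ∫ ξ, h ξ * synth f ξ := by
  simp only [synth, ← integral_mul_const, ← integral_const_mul]
  rw [integral_integral_swap]
  · congr 1 with ξ
    congr 1 with x
    rw [real_inner_comm]
    ring
  · have : Integrable (fun p : Rd d × Rd d => f p.1 * h p.2) := hf.mul_prod hh
    refine (this.bdd_mul (c := 1)
      (f := fun p => Complex.exp (Complex.I * ((inner ℝ p.1 p.2 : ℝ) : ℂ)))
      (Continuous.aestronglyMeasurable (by fun_prop))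
      (Eventually.of_forall fun p => (norm_character _).le)).congr
      (Eventually.of_forall fun p => ?_)
    simp only [Function.uncurry]
    ring

/-- Fourier inversion: the prefactor `(2π)^{-d}` cancels the Jacobian of the dilation by `(2π)⁻¹`.
-/
theorem synth_schwartzHat (φ : 𝓢(Rd d, ℂ)) (ξ : Rd d) : synth (schwartzHat φ) ξ = φ ξ := by
  have h2 : (0 : ℝ) < 2 * Real.pi := by positivity
  have e : ∀ x : Rd d, Complex.exp (Complex.I * ((inner ℝ ξ x : ℝ) : ℂ)) * schwartzHat φ x =
      (((2 * Real.pi) ^ d)⁻¹ : ℝ) • (fun y : Rd d =>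
        Complex.exp (((2 * Real.pi * inner ℝ y ξ : ℝ) : ℂ) * Complex.I) • 𝓕 φ y)
          ((2 * Real.pi)⁻¹ • x) := by
    intro x
    simp only [schwartzHat_eq, real_inner_smul_left, smul_eq_mul, Complex.real_smul]
    rw [mul_inv_cancel_left₀ h2.ne', real_inner_comm]
    ring_nf
  have e1 : ∫ y : Rd d, Complex.exp (((2 * Real.pi * inner ℝ y ξ : ℝ) : ℂ) * Complex.I) • 𝓕 φ y
      = φ ξ := by
    rw [← Real.fourierInv_eq', ← SchwartzMap.fourierInv_coe,
      FourierTransform.fourierInv_fourier_eq]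
  rw [synth, integral_congr_ae (Eventually.of_forall e), integral_smul,
    Measure.integral_comp_smul volume (fun y : Rd d =>
      Complex.exp (((2 * Real.pi * inner ℝ y ξ : ℝ) : ℂ) * Complex.I) • 𝓕 φ y), e1,
    finrank_euclideanSpace_fin, smul_smul,
    abs_of_pos (by positivity), inv_pow, inv_inv, inv_mul_cancel₀ (by positivity), one_smul]

theorem isTempered_of_integrable {h : Rd d → ℂ} (hh : Integrable h) : IsTempered h := by
  intro φ
  refine hh.mul_bdd (c := ‖φ.toBoundedContinuousFunction‖) φ.continuous.aestronglyMeasurable ?_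
  exact Eventually.of_forall fun x => φ.toBoundedContinuousFunction.norm_coe_le_norm x

theorem isTempered_synth {h : Rd d → ℂ} (hh : Integrable h) : IsTempered (synth h) := fun φ =>
  φ.integrable.bdd_mul (continuous_synth hh).aestronglyMeasurable
    (Eventually.of_forall (norm_synth_le h))

theorem isTempered_congr {g k : Rd d → ℂ} (e : g =ᵐ[volume] k) (hk : IsTempered k) :
    IsTempered g := fun φ => (hk φ).congr (by filter_upwards [e] with x hx; rw [hx])

theorem integrable_schwartzHat (φ : 𝓢(Rd d, ℂ)) : Integrable (schwartzHat φ) := by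
  obtain ⟨ψ, hψ⟩ := exists_schwartz_eq_hat φ
  exact ψ.integrable.congr (Eventually.of_forall hψ)

theorem integral_synth_mul_schwartzHat {h : Rd d → ℂ} (hh : Integrable h) (φ : 𝓢(Rd d, ℂ)) :
    ∫ x, synth h x * schwartzHat φ x = ∫ ξ, h ξ * φ ξ := by
  rw [integral_synth_mul hh (integrable_schwartzHat φ)]
  simp only [synth_schwartzHat]

theorem ae_eq_of_synth_eq {h k : Rd d → ℂ} (hh : Integrable h) (hk : Integrable k)
    (e : synth h = synth k) : h =ᵐ[volume] k :=
  (isTempered_of_integrable hh).ae_eq (isTempered_of_integrable hk) fun φ => by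
    rw [← integral_synth_mul_schwartzHat hh, e, integral_synth_mul_schwartzHat hk]

/-- Replaces the distributional definition by a pointwise formula. Every Schwartz function is a
`schwartzHat`, so pairing with transforms tests against all Schwartz functions. -/
theorem hasFourier_iff_ae_eq_synth {g : Fn d} {h : Rd d → ℂ} (hh : Integrable h) :
    HasFourier g h ↔ (fun x => ((g x : ℝ) : ℂ)) =ᵐ[volume] synth h := by
  constructor
  · intro H
    refine H.tempered_left.ae_eq (isTempered_synth hh) fun ψ => ?_
    obtain ⟨φ, hφ⟩ := exists_hat_eq_schwartz ψ
    simp only [← hφ]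
    rw [H.eq, integral_synth_mul_schwartzHat hh]
  · intro e
    refine ⟨isTempered_congr e (isTempered_synth hh), isTempered_of_integrable hh, fun φ => ?_⟩
    rw [← integral_synth_mul_schwartzHat hh]
    refine integral_congr_ae ?_
    filter_upwards [e] with x hx
    rw [hx]

/-! ### The Helmholtz equation on the Fourier side. -/

open Laplacian

theorem synth_helmholtz (α : ℝ) (φ : 𝓢(Rd d, ℂ)) (ξ : Rd d) :
    synth (fun x => (α : ℂ) * φ x - Δ φ x) ξ = ((α + ‖ξ‖ ^ 2 : ℝ) : ℂ) * synth φ ξ := by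
  have hΔ : synth (Δ φ : 𝓢(Rd d, ℂ)) ξ = -((‖ξ‖ ^ 2 : ℝ) : ℂ) * synth φ ξ := by
    rw [synth_eq_fourierInv, synth_eq_fourierInv, Real.fourierInv_eq_fourier_neg,
      Real.fourierInv_eq_fourier_neg, ← SchwartzMap.fourier_coe, ← SchwartzMap.fourier_coe,
      SchwartzMap.laplacian_eq_fourierMultiplierCLM, FourierTransform.fourier_smul,
      SchwartzMap.fourierMultiplierCLM_apply, FourierTransform.fourier_fourierInv_eq,
      smul_apply, SchwartzMap.smulLeftCLM_apply_apply (by fun_prop)]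
    simp only [norm_neg, norm_smul, Complex.real_smul]
    rw [Real.norm_of_nonneg (by positivity)]
    have : (Real.pi : ℂ) ≠ 0 := by exact_mod_cast Real.pi_ne_zero
    push_cast
    field_simp
  simp only [sub_eq_add_neg, ← neg_one_mul (DFunLike.coe (Δ φ : 𝓢(Rd d, ℂ)) _)]
  rw [synth_add (φ.integrable.const_mul _) ((Δ φ).integrable.const_mul _), synth_const_mul,
    synth_const_mul, hΔ]
  push_cast
  ring

/-- A function with integrable transform is mapped by `(α - Δ)⁻¹` to the function with the
transform divided by `α + |ξ|²`. -/
theorem solvesHelmholtz_of_synth {α : ℝ} {g v : Fn d} {h k : Rd d → ℂ}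
    (hh : Integrable h) (hk : Integrable k)
    (e : ∀ᵐ ξ, ((α + ‖ξ‖ ^ 2 : ℝ) : ℂ) * h ξ = k ξ)
    (hv : (fun x => ((v x : ℝ) : ℂ)) =ᵐ[volume] synth h)
    (hg : (fun x => ((g x : ℝ) : ℂ)) =ᵐ[volume] synth k) : SolvesHelmholtz α g v := by
  refine ⟨isTempered_congr hv (isTempered_synth hh), isTempered_congr hg (isTempered_synth hk),
    fun φ => ?_⟩
  have hf : Integrable fun x => (α : ℂ) * φ x - Δ φ x :=
    (φ.integrable.const_mul _).sub (Δ φ).integrable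
  calc ∫ x, ((v x : ℝ) : ℂ) * ((α : ℂ) * φ x - Δ φ x)
      = ∫ x, synth h x * ((α : ℂ) * φ x - Δ φ x) :=
        integral_congr_ae (by filter_upwards [hv] with x hx; rw [hx])
    _ = ∫ ξ, k ξ * synth φ ξ := by
        rw [integral_synth_mul hh hf]
        refine integral_congr_ae ?_
        filter_upwards [e] with ξ hξ
        rw [synth_helmholtz, ← hξ]
        ring
    _ = ∫ x, ((g x : ℝ) : ℂ) * φ x := by
        rw [← integral_synth_mul hk φ.integrable]
        exact integral_congr_ae (by filter_upwards [hg] with x hx; rw [hx])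

/-- Solvability on test functions yields, by duality, uniqueness among tempered functions. The
solution is the Fourier multiplier with symbol `1/(α + 4π²|y|²)`. -/
theorem exists_helmholtz_eq {α : ℝ} (hα : 0 < α) (ψ : 𝓢(Rd d, ℂ)) :
    ∃ φ : 𝓢(Rd d, ℂ), ∀ x, (α : ℂ) * φ x - Δ φ x = ψ x := by
  -- Chosen so that `α + 4π²|y|² = α (1 + |c y|²)`, which reduces the temperate growth of `m` to
  -- that of `(1 + |y|²)⁻¹`.
  let c : ℝ := 2 * Real.pi / √α
  let m : Rd d → ℝ := fun y => α⁻¹ * (1 + ‖c • y‖ ^ 2) ^ (-1 : ℝ)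
  have hm : m.HasTemperateGrowth := by
    have := (Function.hasTemperateGrowth_one_add_norm_sq_rpow (Rd d) (-1)).comp
      (c • ContinuousLinearMap.id ℝ (Rd d)).hasTemperateGrowth
    exact (Function.HasTemperateGrowth.const α⁻¹).mul this
  have hm' : ∀ y : Rd d, (α + (2 * Real.pi) ^ 2 * ‖y‖ ^ 2) * m y = 1 := by
    intro y
    simp only [m, c, norm_smul, Real.rpow_neg_one, mul_pow, Real.norm_eq_abs, sq_abs, div_pow,
      Real.sq_sqrt hα.le]
    have : 0 < α + (2 * Real.pi) ^ 2 * ‖y‖ ^ 2 := by positivity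
    field_simp
  refine ⟨SchwartzMap.fourierMultiplierCLM ℂ m ψ, fun x => ?_⟩
  have key : (α : ℂ) • SchwartzMap.fourierMultiplierCLM ℂ m ψ
      - Δ (SchwartzMap.fourierMultiplierCLM ℂ m ψ) = ψ := by
    rw [SchwartzMap.laplacian_eq_fourierMultiplierCLM,
      SchwartzMap.fourierMultiplierCLM_fourierMultiplierCLM_apply (by fun_prop) hm]
    apply Function.LeftInverse.injective (g := fun f : 𝓢(Rd d, ℂ) => (𝓕⁻ f : 𝓢(Rd d, ℂ)))
      (f := fun f => 𝓕 f) FourierTransform.fourierInv_fourier_eq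
    change 𝓕 _ = 𝓕 ψ
    rw [sub_eq_add_neg, FourierTransform.fourier_add, ← neg_one_smul ℝ,
      FourierTransform.fourier_smul, FourierTransform.fourier_smul, FourierTransform.fourier_smul,
      SchwartzMap.fourierMultiplierCLM_apply, SchwartzMap.fourierMultiplierCLM_apply,
      FourierTransform.fourier_fourierInv_eq, FourierTransform.fourier_fourierInv_eq]
    ext y
    simp only [add_apply, smul_apply]
    rw [SchwartzMap.smulLeftCLM_apply_apply hm, SchwartzMap.smulLeftCLM_apply_apply (by fun_prop)]
    simp only [Pi.mul_apply, Complex.real_smul, smul_eq_mul]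
    have h1 : ((α : ℂ) + (2 * Real.pi) ^ 2 * ‖y‖ ^ 2) * (m y : ℂ) = 1 := by
      exact_mod_cast hm' y
    push_cast
    linear_combination (𝓕 ψ y) * h1
  simpa using congrArg (fun f : 𝓢(Rd d, ℂ) => f x) key

theorem SolvesHelmholtz.unique {α : ℝ} (hα : 0 < α) {g v v' : Fn d}
    (hv : SolvesHelmholtz α g v) (hv' : SolvesHelmholtz α g v') : v = v' := by
  refine AEEqFun.ext ?_
  have : (fun x => ((v x : ℝ) : ℂ)) =ᵐ[volume] fun x => ((v' x : ℝ) : ℂ) := by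
    refine hv.tempered_left.ae_eq hv'.tempered_left fun ψ => ?_
    obtain ⟨φ, hφ⟩ := exists_helmholtz_eq hα ψ
    simp only [← hφ]
    rw [hv.eq, hv'.eq]
  filter_upwards [this] with x hx
  exact_mod_cast hx

theorem SolvesHelmholtz.eq_helmholtzInv {α : ℝ} (hα : 0 < α) {g v : Fn d}
    (hv : SolvesHelmholtz α g v) : v = helmholtzInv α g := by
  have h : ∃ v, SolvesHelmholtz α g v := ⟨v, hv⟩
  rw [helmholtzInv, dif_pos h]
  exact hv.unique hα h.choose_spec

/-! ### Integral and multiplication operators on `L¹`; compactness. -/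

section IntegralOperators

variable {X F : Type*} [MeasurableSpace X] {μ : Measure X}
  [NormedAddCommGroup F] [NormedSpace ℝ F] [NormedSpace ℂ F] [IsScalarTower ℝ ℂ F]

omit [NormedSpace ℝ F] [IsScalarTower ℝ ℂ F] in
theorem integrable_L1_smul [TopologicalSpace X] [OpensMeasurableSpace X]
    [SecondCountableTopology X] [TopologicalSpace.PseudoMetrizableSpace X] {Φ : X → F}
    (hΦ : Continuous Φ) {B : ℝ} (hB : ∀ η, ‖Φ η‖ ≤ B) (H : Lp ℂ 1 μ) :
    Integrable (fun η => H η • Φ η) μ :=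
  (L1.integrable_coeFn H).smul_bdd B hΦ.aestronglyMeasurable (Eventually.of_forall hB)

/-- The operator `H ↦ ∫ H(η) Φ(η) dη` on `L¹` given by a bounded continuous family `Φ`. -/
theorem exists_integralOperator [TopologicalSpace X] [OpensMeasurableSpace X]
    [SecondCountableTopology X] [TopologicalSpace.PseudoMetrizableSpace X] {Φ : X → F}
    (hΦ : Continuous Φ) {B : ℝ} (hB : ∀ η, ‖Φ η‖ ≤ B) :
    ∃ A : Lp ℂ 1 μ →L[ℂ] F, ∀ H, A H = ∫ η, H η • Φ η ∂μ := by
  refine ⟨LinearMap.mkContinuous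
    { toFun := fun H => ∫ η, H η • Φ η ∂μ
      map_add' := fun H H' => ?_
      map_smul' := fun c H => ?_ } B fun H => ?_, fun H => rfl⟩
  · rw [← integral_add (integrable_L1_smul hΦ hB H) (integrable_L1_smul hΦ hB H')]
    refine integral_congr_ae ?_
    filter_upwards [Lp.coeFn_add H H'] with η h
    rw [h, Pi.add_apply, add_smul]
  · rw [← integral_smul]
    refine integral_congr_ae ?_
    filter_upwards [Lp.coeFn_smul c H] with η h
    rw [h, Pi.smul_apply, smul_assoc, RingHom.id_apply]
  · rw [L1.norm_eq_integral_norm, ← integral_const_mul]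
    refine norm_integral_le_of_norm_le ((L1.integrable_coeFn H).norm.const_mul B)
      (Eventually.of_forall fun η => ?_)
    rw [norm_smul, mul_comm]
    exact mul_le_mul_of_nonneg_right (hB η) (norm_nonneg _)

/-- An integral operator on `L¹` whose family of kernels vanishes at infinity is compact: the image
of the unit ball lies in the closed convex hull of a compact set. -/
theorem isCompactOperator_of_tendsto_zero [CompleteSpace F] [TopologicalSpace X]
    [OpensMeasurableSpace X] [SecondCountableTopology X] [TopologicalSpace.PseudoMetrizableSpace X]
    {Φ : X → F} (hΦ : Continuous Φ) {B : ℝ} (hB : ∀ η, ‖Φ η‖ ≤ B)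
    (h0 : Tendsto Φ (cocompact X) (𝓝 0)) {A : Lp ℂ 1 μ →L[ℂ] F}
    (hA : ∀ H, A H = ∫ η, H η • Φ η ∂μ) : IsCompactOperator A := by
  have hK : IsCompact (insert 0 (Set.range Φ)) := h0.isCompact_insert_range_of_cocompact hΦ
  -- The unit disc absorbs the phase of `H η`; adjoining the limit `0` makes the range of `Φ`
  -- compact.
  let K : Set F := (fun p : ℂ × F => p.1 • p.2) '' (Metric.closedBall 0 1 ×ˢ insert 0 (Set.range Φ))
  have hKc : IsCompact K := ((isCompact_closedBall _ _).prod hK).image continuous_smul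
  let S : Set F := closure (convexHull ℝ K)
  have hS : IsCompact S :=
    (hKc.totallyBounded.convexHull.closure).isCompact_of_isClosed isClosed_closure
  have hKS : K ⊆ S := (subset_convexHull ℝ K).trans subset_closure
  refine (isCompactOperator_iff_image_closedBall_subset_compact (r := 1)
    (A : Lp ℂ 1 μ →ₗ[ℂ] F) one_pos).2 ⟨S, hS, ?_⟩
  rintro _ ⟨H, hH, rfl⟩
  -- A real functional `f` separating `A H` from `S` would have `f < u` on `S` and `f (A H) > u`.
  -- But `f (A H)` is the integral of `‖H η‖` times values of `f` on `K`, hence at most `‖H‖ u ≤ u`;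
  -- the last inequality uses `u > 0`, which holds because `0 ∈ S`.
  by_contra hy
  obtain ⟨f, u, hfu, huy⟩ := geometric_hahn_banach_closed_point
    (convex_convexHull ℝ K).closure isClosed_closure hy
  have hu : 0 < u := by
    have := hfu 0 (hKS ⟨(0, 0), ⟨by simp, by simp⟩, by simp⟩)
    simpa using this
  refine absurd huy (not_lt.2 ?_)
  change f (A H) ≤ u
  have hi := integrable_L1_smul (μ := μ) hΦ hB H
  rw [hA, ← f.integral_comp_comm hi]
  calc ∫ η, f (H η • Φ η) ∂μ ≤ ∫ η, ‖H η‖ * u ∂μ := by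
        refine integral_mono (f.integrable_comp hi)
          ((L1.integrable_coeFn H).norm.mul_const u) fun η => ?_
        -- Where `H η = 0` the normalized phase is `0`, still in the disc.
        have hmem : ((‖H η‖⁻¹ : ℝ) • H η) • Φ η ∈ K := by
          refine ⟨((‖H η‖⁻¹ : ℝ) • H η, Φ η), ⟨?_, Or.inr ⟨η, rfl⟩⟩, rfl⟩
          rw [mem_closedBall_zero_iff, norm_smul, norm_inv, norm_norm]
          exact inv_mul_le_one
        have h1 : H η • Φ η = ‖H η‖ • ((‖H η‖⁻¹ : ℝ) • H η) • Φ η := by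
          rcases eq_or_ne (H η) 0 with h | h
          · simp [h]
          · rw [← smul_assoc, smul_smul, mul_inv_cancel₀ (norm_ne_zero_iff.2 h), one_smul]
        change f (H η • Φ η) ≤ _
        rw [h1, map_smul, smul_eq_mul]
        exact mul_le_mul_of_nonneg_left (hfu _ (hKS hmem)).le (norm_nonneg _)
    _ ≤ u := by
        rw [integral_mul_const, ← L1.norm_eq_integral_norm]
        exact mul_le_of_le_one_left hu.le (mem_closedBall_zero_iff.1 hH)

/-- Multiplication by a bounded function on `L¹`. -/
theorem exists_multiplicationOperator {c : X → ℂ} (hc : AEStronglyMeasurable c μ) {B : ℝ}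
    (hB : ∀ x, ‖c x‖ ≤ B) : ∃ M : Lp ℂ 1 μ →L[ℂ] Lp ℂ 1 μ, ∀ f, M f =ᵐ[μ] fun x => c x * f x := by
  have hi : ∀ f : Lp ℂ 1 μ, Integrable (fun x => c x * f x) μ := fun f =>
    (L1.integrable_coeFn f).bdd_mul hc (Eventually.of_forall hB)
  refine ⟨LinearMap.mkContinuous
    { toFun := fun f => (hi f).toL1 _
      map_add' := fun f g => ?_
      map_smul' := fun a f => ?_ } B fun f => ?_, fun f => (hi f).coeFn_toL1⟩
  · rw [← Integrable.toL1_add]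
    refine (Integrable.toL1_eq_toL1_iff _ _ _ _).2 ?_
    filter_upwards [Lp.coeFn_add f g] with x h
    simp only [h, Pi.add_apply, mul_add]
  · rw [RingHom.id_apply, ← Integrable.toL1_smul]
    refine (Integrable.toL1_eq_toL1_iff _ _ _ _).2 ?_
    filter_upwards [Lp.coeFn_smul a f] with x h
    simp only [h, Pi.smul_apply, smul_eq_mul, mul_left_comm]
  · change ‖(hi f).toL1 _‖ ≤ _
    rw [L1.norm_eq_integral_norm, L1.norm_eq_integral_norm, ← integral_const_mul]
    refine integral_mono_ae (L1.integrable_coeFn _).norm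
      ((L1.integrable_coeFn f).norm.const_mul B) ?_
    filter_upwards [(hi f).coeFn_toL1] with x hx
    rw [hx, norm_mul]
    exact mul_le_mul_of_nonneg_right (hB x) (norm_nonneg _)

end IntegralOperators

/-! ### Weighted convolution kernels and the operators they define. -/

theorem norm_toL1 {h : Rd d → ℂ} (hh : Integrable h) : ‖hh.toL1 h‖ = ∫ ξ, ‖h ξ‖ := by
  rw [L1.norm_eq_integral_norm]
  refine integral_congr_ae ?_
  filter_upwards [hh.coeFn_toL1] with x hx
  rw [hx]

/-- The family `η ↦ (a(η, ·) G)(· - η)` of integrable functions. -/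
theorem exists_translated_family {a : Rd d → Rd d → ℂ}
    (ha : Continuous fun p : Rd d × Rd d => a p.1 p.2) {C : ℝ} (hC : ∀ η ζ, ‖a η ζ‖ ≤ C)
    {G : Rd d → ℂ} (hG : Integrable G) :
    ∃ Φ : Rd d → Lp ℂ 1 (volume : Measure (Rd d)), Continuous Φ ∧
      (∀ η, Φ η =ᵐ[volume] fun ξ => a η (ξ - η) * G (ξ - η)) ∧
      ∀ η, ‖Φ η‖ = ∫ ζ, ‖a η ζ * G ζ‖ := by
  have hi : ∀ η, Integrable fun ζ => a η ζ * G ζ := fun η =>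
    hG.bdd_mul (Continuous.aestronglyMeasurable (by fun_prop)) (Eventually.of_forall (hC η))
  let Ψ : Rd d → Lp ℂ 1 (volume : Measure (Rd d)) := fun η => (hi η).toL1 _
  have hΨ : Continuous Ψ := by
    rw [continuous_iff_continuousAt]
    intro η₀
    rw [ContinuousAt, tendsto_iff_norm_sub_tendsto_zero]
    have e : ∀ η, ‖Ψ η - Ψ η₀‖ = ∫ ζ, ‖a η ζ * G ζ - a η₀ ζ * G ζ‖ := fun η => by
      rw [← Integrable.toL1_sub]
      exact norm_toL1 ((hi η).sub (hi η₀))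
    simp only [e]
    have h0 : ∫ ζ, ‖a η₀ ζ * G ζ - a η₀ ζ * G ζ‖ = 0 := by simp
    rw [← h0]
    refine tendsto_integral_filter_of_dominated_convergence (fun ζ => (C + C) * ‖G ζ‖)
      (Eventually.of_forall fun η => ((hi η).sub (hi η₀)).norm.aestronglyMeasurable)
      (Eventually.of_forall fun η => Eventually.of_forall fun ζ => ?_) (hG.norm.const_mul _)
      (Eventually.of_forall fun ζ => ?_)
    · rw [norm_norm, ← sub_mul, norm_mul]
      exact mul_le_mul_of_nonneg_right
        ((norm_sub_le _ _).trans (add_le_add (hC _ _) (hC _ _))) (norm_nonneg _)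
    · exact ((by fun_prop : Continuous fun η => ‖a η ζ * G ζ - a η₀ ζ * G ζ‖)).tendsto η₀
  -- Translation acts jointly continuously and isometrically on `L¹`, so continuity and norms reduce
  -- to the untranslated family `Ψ`.
  refine ⟨fun η => DomAddAct.mk (-η) +ᵥ Ψ η, ?_, fun η => ?_, fun η => ?_⟩
  · have : Fact ((1 : ENNReal) ≠ ⊤) := ⟨ENNReal.one_ne_top⟩
    exact (DomAddAct.continuous_mk.comp continuous_neg).vadd hΨ
  · refine (DomAddAct.vadd_Lp_ae_eq _ _).trans ?_
    have := (measurePreserving_add_left (volume : Measure (Rd d))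
      (-η)).quasiMeasurePreserving.ae_eq_comp
      (hi η).coeFn_toL1
    filter_upwards [this] with ξ hξ
    rw [sub_eq_neg_add]
    exact hξ
  · change ‖DomAddAct.mk (-η) +ᵥ Ψ η‖ = _
    rw [DomAddAct.norm_vadd_Lp, norm_toL1]

theorem one_le_weight {s : ℝ} (hs : 0 ≤ s) (ξ : Rd d) : 1 ≤ weight s ξ :=
  Real.one_le_rpow (le_add_of_nonneg_right (by positivity)) (by positivity)

/-- Peetre's inequality. -/
theorem weight_add_le {s : ℝ} (hs : 0 ≤ s) (ζ η : Rd d) :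
    weight s (ζ + η) ≤ 2 ^ (s / 2) * (weight s η * weight s ζ) := by
  unfold weight
  rw [← Real.mul_rpow (by positivity) (by positivity),
    ← Real.mul_rpow (by positivity) (by positivity)]
  refine Real.rpow_le_rpow (by positivity) ?_ (by positivity)
  have h1 := norm_add_le ζ η
  have h2 : ‖ζ + η‖ ^ 2 ≤ (‖ζ‖ + ‖η‖) ^ 2 := pow_le_pow_left₀ (norm_nonneg _) h1 2
  -- `2(1 + a²)(1 + b²) - (1 + (a + b)²) = 1 + (a - b)² + 2a²b²`.
  nlinarith [sq_nonneg (‖ζ‖ - ‖η‖), sq_nonneg (‖ζ‖ * ‖η‖)]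

/-- Division by the weight, from `L¹` to the transforms of functions in the Barron space. -/
def unweight (s : ℝ) (f : Rd d → ℂ) (ξ : Rd d) : ℂ := (((weight s ξ)⁻¹ : ℝ) : ℂ) * f ξ

theorem norm_inv_weight_le_one {s : ℝ} (hs : 0 ≤ s) (ξ : Rd d) :
    ‖(((weight s ξ)⁻¹ : ℝ) : ℂ)‖ ≤ 1 := by
  rw [Complex.norm_real, norm_inv, Real.norm_of_nonneg (weight_pos s ξ).le]
  exact inv_le_one_of_one_le₀ (one_le_weight hs ξ)

@[fun_prop]
theorem continuous_inv_weight (s : ℝ) : Continuous fun ξ : Rd d => (weight s ξ)⁻¹ :=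
  (continuous_weight s).inv₀ fun ξ => (weight_pos s ξ).ne'

theorem integrable_unweight {s : ℝ} (hs : 0 ≤ s) {f : Rd d → ℂ} (hf : Integrable f) :
    Integrable (unweight s f) :=
  hf.bdd_mul (Continuous.aestronglyMeasurable (by fun_prop))
    (Eventually.of_forall (norm_inv_weight_le_one hs))

theorem unweight_ae_congr (s : ℝ) {f g : Rd d → ℂ} (e : f =ᵐ[volume] g) :
    unweight s f =ᵐ[volume] unweight s g := by
  filter_upwards [e] with ξ h
  rw [unweight, unweight, h]

/-- Evaluation at a point of the function with a given weighted transform. -/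
theorem exists_evaluation {s : ℝ} (hs : 0 ≤ s) (x : Rd d) :
    ∃ L : Lp ℂ 1 (volume : Measure (Rd d)) →L[ℂ] ℂ, ∀ f, L f = synth (unweight s f) x := by
  have hc : Continuous fun ξ : Rd d =>
      Complex.exp (Complex.I * ((inner ℝ x ξ : ℝ) : ℂ)) * (((weight s ξ)⁻¹ : ℝ) : ℂ) := by fun_prop
  obtain ⟨L, hL⟩ := exists_integralOperator (μ := (volume : Measure (Rd d))) hc (B := 1) fun ξ => by
    rw [norm_mul, norm_character, one_mul]
    exact norm_inv_weight_le_one hs ξ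
  refine ⟨L, fun f => (hL f).trans (integral_congr_ae (Eventually.of_forall fun ξ => ?_))⟩
  simp only [unweight, smul_eq_mul]
  ring

theorem integrable_unweight_Lp {s : ℝ} (hs : 0 ≤ s) (f : Lp ℂ 1 (volume : Measure (Rd d))) :
    Integrable (unweight s f) := integrable_unweight hs (L1.integrable_coeFn f)

/-- The family of the integral operator "convolution with `κ`, then multiplication by `c`" on the
weighted space. -/
theorem exists_convolution_family {s : ℝ} (hs : 0 ≤ s) {κ : Rd d → ℂ}
    (hκ : Integrable fun ξ => ((weight s ξ : ℝ) : ℂ) * κ ξ) {c : Rd d → ℂ} (hc : Continuous c)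
    {B : ℝ} (hB : ∀ ξ, ‖c ξ‖ ≤ B) :
    ∃ Φ : Rd d → Lp ℂ 1 (volume : Measure (Rd d)), Continuous Φ ∧ (∃ C, ∀ η, ‖Φ η‖ ≤ C) ∧
      (∀ η, Φ η =ᵐ[volume] fun ξ => c ξ * (((weight s ξ / weight s η : ℝ) : ℂ) * κ (ξ - η))) ∧
      (Tendsto c (cocompact (Rd d)) (𝓝 0) → Tendsto Φ (cocompact (Rd d)) (𝓝 0)) := by
  have hw := continuous_weight (d := d) s
  -- With `ζ = ξ - η`, the kernel `weight ξ / weight η · κ(ξ - η)` is `r η ζ` times the integrable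
  -- function `weight ζ · κ ζ`; Peetre's inequality bounds `r`.
  let r : Rd d → Rd d → ℝ := fun η ζ => weight s (ζ + η) * ((weight s η)⁻¹ * (weight s ζ)⁻¹)
  have hr : ∀ η ζ, ‖((r η ζ : ℝ) : ℂ)‖ ≤ 2 ^ (s / 2) := fun η ζ => by
    have h1 := weight_pos s η
    have h2 := weight_pos s ζ
    have h3 := weight_pos s (ζ + η)
    rw [Complex.norm_real, Real.norm_of_nonneg (by positivity)]
    simp only [r]
    rw [← mul_inv, ← div_eq_mul_inv, div_le_iff₀ (by positivity)]
    exact weight_add_le hs ζ η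
  let a : Rd d → Rd d → ℂ := fun η ζ => c (ζ + η) * ((r η ζ : ℝ) : ℂ)
  have ha : Continuous fun p : Rd d × Rd d => a p.1 p.2 := by
    have hr' : Continuous fun p : Rd d × Rd d => r p.1 p.2 :=
      (hw.comp (by fun_prop)).mul (((continuous_inv_weight s).comp continuous_fst).mul
        ((continuous_inv_weight s).comp continuous_snd))
    exact (hc.comp (by fun_prop)).mul (Complex.continuous_ofReal.comp hr')
  have hB0 : 0 ≤ B := (norm_nonneg _).trans (hB 0)
  have hC : ∀ η ζ, ‖a η ζ‖ ≤ B * 2 ^ (s / 2) := fun η ζ => by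
    rw [norm_mul]
    exact mul_le_mul (hB _) (hr η ζ) (norm_nonneg _) hB0
  obtain ⟨Φ, h1, h2, h3⟩ := exists_translated_family ha hC hκ
  refine ⟨Φ, h1, ⟨∫ ζ, B * 2 ^ (s / 2) * ‖((weight s ζ : ℝ) : ℂ) * κ ζ‖, fun η => ?_⟩,
    fun η => ?_, fun h0 => ?_⟩
  · rw [h3]
    refine integral_mono_of_nonneg (Eventually.of_forall fun ζ => norm_nonneg _)
      (hκ.norm.const_mul _) (Eventually.of_forall fun ζ => ?_)
    simp only
    rw [norm_mul (a η ζ)]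
    exact mul_le_mul_of_nonneg_right (hC η ζ) (norm_nonneg _)
  · refine (h2 η).trans (Eventually.of_forall fun ξ => ?_)
    simp only [a, r, sub_add_cancel]
    have h1 : (weight s (ξ - η) : ℂ) ≠ 0 := by exact_mod_cast (weight_pos s _).ne'
    have h2 : (weight s η : ℂ) ≠ 0 := by exact_mod_cast (weight_pos s _).ne'
    push_cast
    field_simp
  · rw [tendsto_zero_iff_norm_tendsto_zero]
    simp only [h3]
    have e0 : (0 : ℝ) = ∫ _ζ : Rd d, (0 : ℝ) := by simp
    rw [e0]
    have : (cocompact (Rd d)).IsCountablyGenerated := by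
      rw [← Metric.cobounded_eq_cocompact, ← comap_norm_atTop]
      infer_instance
    refine tendsto_integral_filter_of_dominated_convergence
      (fun ζ => B * 2 ^ (s / 2) * ‖((weight s ζ : ℝ) : ℂ) * κ ζ‖)
      (Eventually.of_forall fun η => ?_)
      (Eventually.of_forall fun η => Eventually.of_forall fun ζ => ?_) (hκ.norm.const_mul _)
      (Eventually.of_forall fun ζ => ?_)
    · exact ((ha.comp (by fun_prop : Continuous fun ζ => (η, ζ))).aestronglyMeasurable.mul
        hκ.aestronglyMeasurable).norm
    · rw [norm_norm, norm_mul (a η ζ)]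
      exact mul_le_mul_of_nonneg_right (hC η ζ) (norm_nonneg _)
    · have h4 : Tendsto (fun η => c (ζ + η)) (cocompact (Rd d)) (𝓝 0) :=
        h0.comp (Homeomorph.addLeft ζ).isClosedEmbedding.tendsto_cocompact
      have h5 : Tendsto (fun η => a η ζ) (cocompact (Rd d)) (𝓝 0) :=
        h4.zero_mul_isBoundedUnder_le
          (isBoundedUnder_of ⟨2 ^ (s / 2), fun η => hr η ζ⟩)
      simpa using (h5.mul_const (((weight s ζ : ℝ) : ℂ) * κ ζ)).norm

theorem tendsto_inv_helmholtz_symbol (α : ℝ) :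
    Tendsto (fun ξ : Rd d => (((α + ‖ξ‖ ^ 2)⁻¹ : ℝ) : ℂ)) (cocompact (Rd d)) (𝓝 0) := by
  rw [← Complex.ofReal_zero]
  refine (Complex.continuous_ofReal.tendsto 0).comp (tendsto_inv_atTop_zero.comp ?_)
  exact tendsto_atTop_add_const_left _ _
    ((tendsto_pow_atTop two_ne_zero).comp (tendsto_norm_cocompact_atTop (E := Rd d)))

/-- In the weighted `L¹` picture, the operators `u ↦ W u` (first) and `u ↦ (α - Δ)⁻¹ (W u)`
(second), where `κ` is the transform of `W`. -/
theorem exists_schrodinger_operators {s : ℝ} (hs : 0 ≤ s) {α : ℝ} (hα : 0 < α) {κ : Rd d → ℂ}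
    (hκ : Integrable fun ξ => ((weight s ξ : ℝ) : ℂ) * κ ξ) :
    ∃ P A : Lp ℂ 1 (volume : Measure (Rd d)) →L[ℂ] Lp ℂ 1 (volume : Measure (Rd d)),
      IsCompactOperator A ∧
      (∀ H, A H =ᵐ[volume] fun ξ => (((α + ‖ξ‖ ^ 2)⁻¹ : ℝ) : ℂ) * P H ξ) ∧
      ∀ H x, synth (unweight s (P H)) x = synth κ x * synth (unweight s H) x := by
  have hpos : ∀ ξ : Rd d, 0 < α + ‖ξ‖ ^ 2 := fun ξ => by positivity
  have hmc : Continuous fun ξ : Rd d => (((α + ‖ξ‖ ^ 2)⁻¹ : ℝ) : ℂ) :=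
    Complex.continuous_ofReal.comp
      ((by fun_prop : Continuous fun ξ : Rd d => α + ‖ξ‖ ^ 2).inv₀ fun ξ => (hpos ξ).ne')
  have hmb : ∀ ξ : Rd d, ‖(((α + ‖ξ‖ ^ 2)⁻¹ : ℝ) : ℂ)‖ ≤ α⁻¹ := fun ξ => by
    rw [Complex.norm_real, Real.norm_of_nonneg (inv_nonneg.2 (hpos ξ).le)]
    exact inv_anti₀ hα (le_add_of_nonneg_right (by positivity))
  -- `c = 1` gives the kernels of multiplication by `W`; taking `c` to be the inverse Helmholtz
  -- symbol gives those of `A`, which also vanish at infinity.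
  obtain ⟨Φ, h1, ⟨C, hC⟩, h2, -⟩ := exists_convolution_family hs hκ
    (c := fun _ => 1) continuous_const (B := 1) (by simp)
  obtain ⟨Φ', h1', ⟨C', hC'⟩, h2', h3'⟩ := exists_convolution_family hs hκ hmc hmb
  obtain ⟨P, hP⟩ := exists_integralOperator (μ := (volume : Measure (Rd d))) h1 hC
  obtain ⟨M, hM⟩ := exists_multiplicationOperator (μ := (volume : Measure (Rd d)))
    hmc.aestronglyMeasurable hmb
  have hMΦ : ∀ η, M (Φ η) = Φ' η := fun η => by
    refine Lp.ext ((hM _).trans ?_)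
    filter_upwards [h2 η, h2' η] with ξ e e'
    rw [e, e', one_mul]
  refine ⟨P, M.comp P, ?_, fun H => hM (P H), fun H x => ?_⟩
  · refine isCompactOperator_of_tendsto_zero h1' hC' (h3' (tendsto_inv_helmholtz_symbol α))
      fun H => ?_
    change M (P H) = _
    rw [hP, ← M.integral_comp_comm (integrable_L1_smul h1 hC H)]
    simp only [map_smul, hMΦ]
  · obtain ⟨L, hL⟩ := exists_evaluation hs x
    -- Up to the factor `1/weight η`, `Φ η` is the weighted transform of `W` times the character of
    -- frequency `η`; by linearity this gives the product formula for every `H`.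
    have hLΦ : ∀ η, L (Φ η) = synth κ x *
        (Complex.exp (Complex.I * ((inner ℝ x η : ℝ) : ℂ)) * (((weight s η)⁻¹ : ℝ) : ℂ)) := by
      intro η
      rw [hL, synth_congr (unweight_ae_congr s (h2 η)), synth, synth, ← integral_mul_const,
        ← integral_sub_right_eq_self (fun ξ => Complex.exp (Complex.I * ((inner ℝ x ξ : ℝ) : ℂ)) *
          κ ξ * (Complex.exp (Complex.I * ((inner ℝ x η : ℝ) : ℂ)) * (((weight s η)⁻¹ : ℝ) : ℂ))) η]
      congr 1
      ext ξ
      have h1 : (weight s ξ : ℂ) ≠ 0 := by exact_mod_cast (weight_pos s _).ne'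
      have h3 : Complex.exp (Complex.I * ((inner ℝ x ξ : ℝ) : ℂ)) =
          Complex.exp (Complex.I * ((inner ℝ x (ξ - η) : ℝ) : ℂ)) *
            Complex.exp (Complex.I * ((inner ℝ x η : ℝ) : ℂ)) := by
        rw [← Complex.exp_add, inner_sub_right]
        push_cast
        ring_nf
      rw [unweight, h3]
      push_cast
      field_simp
    rw [← hL, hP, ← L.integral_comp_comm (integrable_L1_smul h1 hC H)]
    change _ = synth κ x *
      ∫ η, Complex.exp (Complex.I * ((inner ℝ x η : ℝ) : ℂ)) * unweight s H η
    rw [← integral_const_mul]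
    congr 1
    ext η
    rw [map_smul, hLΦ, unweight, smul_eq_mul]
    ring

/-! ### The maximum principle. -/

/-- Symmetric second difference quotients of `synth h` converge to the second derivative. -/
theorem tendsto_second_difference_synth {h : Rd d → ℂ} (hh : Integrable h) (x e : Rd d)
    (h2 : Integrable fun ξ => (((inner ℝ e ξ : ℝ) ^ 2 : ℝ) : ℂ) * h ξ) :
    Tendsto (fun t : ℝ => (((t ^ 2)⁻¹ : ℝ) : ℂ) *
        (synth h (x + t • e) + synth h (x - t • e) - 2 * synth h x)) (𝓝[≠] 0)
      (𝓝 (-synth (fun ξ => (((inner ℝ e ξ : ℝ) ^ 2 : ℝ) : ℂ) * h ξ) x)) := by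
  let E : Rd d → ℂ := fun ξ => Complex.exp (Complex.I * ((inner ℝ x ξ : ℝ) : ℂ))
  -- `e^{2iθ} + e^{-2iθ} - 2 = -4 sin² θ` with `θ = t⟨e, ξ⟩/2`. Then `|sin θ| ≤ |θ|` dominates the
  -- integrand by `⟨e, ξ⟩² |h|`.
  have key : ∀ t : ℝ, (((t ^ 2)⁻¹ : ℝ) : ℂ) *
      (synth h (x + t • e) + synth h (x - t • e) - 2 * synth h x) =
      ∫ ξ, E ξ * ((-4 * (t⁻¹ * Real.sin (t * (inner ℝ e ξ / 2))) ^ 2 : ℝ) * h ξ) := by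
    intro t
    have hp : Integrable fun ξ => Complex.exp (Complex.I * ((inner ℝ (x + t • e) ξ : ℝ) : ℂ)) * h ξ
        + Complex.exp (Complex.I * ((inner ℝ (x - t • e) ξ : ℝ) : ℂ)) * h ξ :=
      (integrable_character_mul hh _).add (integrable_character_mul hh _)
    rw [synth, synth, synth, ← integral_const_mul, ← integral_add (integrable_character_mul hh _)
      (integrable_character_mul hh _), ← integral_sub hp
      ((integrable_character_mul hh _).const_mul _), ← integral_const_mul]
    congr 1
    ext ξ
    have e1 : Complex.I * ((inner ℝ (x + t • e) ξ : ℝ) : ℂ) =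
        Complex.I * ((inner ℝ x ξ : ℝ) : ℂ) + ((t * (inner ℝ e ξ / 2) : ℝ) : ℂ) * Complex.I
          + ((t * (inner ℝ e ξ / 2) : ℝ) : ℂ) * Complex.I := by
      rw [inner_add_left, real_inner_smul_left]
      push_cast
      ring
    have e2 : Complex.I * ((inner ℝ (x - t • e) ξ : ℝ) : ℂ) =
        Complex.I * ((inner ℝ x ξ : ℝ) : ℂ) + -((t * (inner ℝ e ξ / 2) : ℝ) : ℂ) * Complex.I
          + -((t * (inner ℝ e ξ / 2) : ℝ) : ℂ) * Complex.I := by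
      rw [inner_sub_left, real_inner_smul_left]
      push_cast
      ring
    generalize t * (inner ℝ e ξ / 2 : ℝ) = θ at e1 e2 ⊢
    have e4 : ((-4 * (t⁻¹ * Real.sin θ) ^ 2 : ℝ) : ℂ) = -4 * ((t : ℂ)⁻¹ * ((Complex.exp (-(θ : ℂ) *
        Complex.I) - Complex.exp ((θ : ℂ) * Complex.I)) * Complex.I / 2)) ^ 2 := by
      push_cast
      rw [Complex.sin]
    simp only [e1, e2, e4, Complex.exp_add, E]
    have e3 : Complex.exp ((θ : ℂ) * Complex.I) *
        Complex.exp (-(θ : ℂ) * Complex.I) = 1 := by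
      rw [← Complex.exp_add]
      simp
    generalize Complex.exp ((θ : ℂ) * Complex.I) = p at *
    generalize Complex.exp (-(θ : ℂ) * Complex.I) = q at *
    push_cast
    linear_combination (2 * (((t : ℂ)⁻¹) ^ 2) *
      Complex.exp (Complex.I * ((inner ℝ x ξ : ℝ) : ℂ)) * h ξ) * e3
      + ((q - p) ^ 2 * (((t : ℂ)⁻¹) ^ 2) *
      Complex.exp (Complex.I * ((inner ℝ x ξ : ℝ) : ℂ)) * h ξ) * Complex.I_sq
  simp only [key]
  rw [synth, ← integral_neg]
  refine tendsto_integral_filter_of_dominated_convergence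
    (fun ξ => ‖(((inner ℝ e ξ : ℝ) ^ 2 : ℝ) : ℂ) * h ξ‖) (Eventually.of_forall fun t => ?_) ?_
    h2.norm (Eventually.of_forall fun ξ => ?_)
  · exact (Continuous.aestronglyMeasurable (by fun_prop)).mul
      ((Continuous.aestronglyMeasurable (by fun_prop)).mul hh.aestronglyMeasurable)
  · filter_upwards [self_mem_nhdsWithin] with t ht
    refine Eventually.of_forall fun ξ => ?_
    rw [norm_mul, norm_character, one_mul, norm_mul, norm_mul, Complex.norm_real,
      Complex.norm_real]
    refine mul_le_mul_of_nonneg_right ?_ (norm_nonneg _)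
    rw [norm_mul, norm_neg, norm_pow, norm_pow, norm_mul, norm_inv]
    have h3 : ‖Real.sin (t * (inner ℝ e ξ / 2))‖ ≤ ‖t‖ * (‖(inner ℝ e ξ : ℝ)‖ / 2) := by
      refine Real.abs_sin_le_abs.trans_eq ?_
      rw [abs_mul, abs_div, abs_two]
      rfl
    have h4 : ‖t‖⁻¹ * ‖Real.sin (t * (inner ℝ e ξ / 2))‖ ≤ ‖(inner ℝ e ξ : ℝ)‖ / 2 :=
      (inv_mul_le_iff₀ (norm_pos_iff.2 ht)).2 h3
    have h5 := pow_le_pow_left₀ (by positivity) h4 2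
    rw [Real.norm_of_nonneg (by norm_num : (0 : ℝ) ≤ 4)]
    linarith
  · have h3 : HasDerivAt (fun t : ℝ => Real.sin (t * (inner ℝ e ξ / 2))) (inner ℝ e ξ / 2) 0 := by
      simpa using ((hasDerivAt_id (0 : ℝ)).mul_const (inner ℝ e ξ / 2 : ℝ)).sin
    have h4 := hasDerivAt_iff_tendsto_slope_zero.1 h3
    simp only [zero_add, zero_mul, Real.sin_zero, sub_zero, smul_eq_mul] at h4
    have h5 : Tendsto (fun t : ℝ => -4 * (t⁻¹ * Real.sin (t * (inner ℝ e ξ / 2))) ^ 2) (𝓝[≠] 0)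
        (𝓝 (-(inner ℝ e ξ : ℝ) ^ 2)) := by
      convert (h4.pow 2).const_mul (-4) using 2
      ring
    have h6 : Tendsto (fun t : ℝ => E ξ *
        (((-4 * (t⁻¹ * Real.sin (t * (inner ℝ e ξ / 2))) ^ 2 : ℝ) : ℂ) * h ξ)) (𝓝[≠] 0)
        (𝓝 (E ξ * (((-(inner ℝ e ξ : ℝ) ^ 2 : ℝ) : ℂ) * h ξ))) :=
      (((Complex.continuous_ofReal.tendsto _).comp h5).mul_const (h ξ)).const_mul (E ξ)
    convert h6 using 2
    simp only [E]
    push_cast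
    ring

/-- A maximum principle: if `u = Re (synth h)`, a function vanishing at infinity, is subharmonic
where it is positive, then `u ≤ 0`. -/
theorem re_synth_nonpos (hd : 1 ≤ d) {h : Rd d → ℂ} (hh : Integrable h)
    (h2 : Integrable fun ξ => ((‖ξ‖ ^ 2 : ℝ) : ℂ) * h ξ)
    (hsub : ∀ x, 0 < (synth h x).re →
      (synth (fun ξ => ((‖ξ‖ ^ 2 : ℝ) : ℂ) * h ξ) x).re ≤ 0) (x : Rd d) :
    (synth h x).re ≤ 0 := by
  by_contra! hx
  let u : Rd d → ℝ := fun y => (synth h y).re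
  have hu : Continuous u := Complex.continuous_re.comp (continuous_synth hh)
  have hu0 : Tendsto u (cocompact (Rd d)) (𝓝 0) :=
    (Complex.continuous_re.tendsto 0).comp (tendsto_synth_cocompact h)
  obtain ⟨R, hR0, hR⟩ : ∃ R : ℝ, 0 < R ∧ ∀ y, R ≤ ‖y‖ → u y < u x / 2 := by
    have h1 : ∀ᶠ y in cocompact (Rd d), u y < u x / 2 :=
      hu0.eventually_lt_const (half_pos hx)
    rw [← Metric.cobounded_eq_cocompact, ← comap_norm_atTop, eventually_comap] at h1
    obtain ⟨R, hR⟩ := eventually_atTop.1 h1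
    exact ⟨max R 1, by positivity, fun y hy => hR _ ((le_max_left _ _).trans hy) y rfl⟩
  -- The penalty `ε|y|²` is at most `u x / 4` on the ball. A maximizer `z` of `φ` thus has `u z ≥ 3
  -- u x / 4`, which excludes the sphere, where `u < u x / 2`.
  let ε : ℝ := u x / (4 * R ^ 2)
  have hε : 0 < ε := by positivity
  have hεR : ε * R ^ 2 = u x / 4 := by simp only [ε]; field_simp
  let φ : Rd d → ℝ := fun y => u y + ε * ‖y‖ ^ 2
  have hφ : Continuous φ := by fun_prop
  have hxR : ‖x‖ < R := by
    by_contra! hc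
    linarith [hR x hc, show 0 < u x from hx]
  obtain ⟨z, hz, hzmax⟩ := (isCompact_closedBall (0 : Rd d) R).exists_isMaxOn
    ⟨x, mem_closedBall_zero_iff.2 hxR.le⟩ hφ.continuousOn
  have hzR : ‖z‖ ≤ R := mem_closedBall_zero_iff.1 hz
  have hφz : u x ≤ u z + ε * ‖z‖ ^ 2 := by
    have h1 : φ x ≤ φ z := hzmax (mem_closedBall_zero_iff.2 hxR.le)
    have h3 : 0 ≤ ε * ‖x‖ ^ 2 := by positivity
    simp only [φ] at h1
    linarith
  have hεz : ε * ‖z‖ ^ 2 ≤ u x / 4 := by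
    rw [← hεR]
    gcongr
  have hx' : 0 < u x := hx
  have hzR' : ‖z‖ < R := by
    by_contra! hc
    linarith [hR z hc]
  have huz : 0 < u z := by linarith
  have hloc : ∀ᶠ y in 𝓝 z, φ y ≤ φ z := by
    filter_upwards [Metric.isOpen_ball.mem_nhds (mem_ball_zero_iff.2 hzR')] with y hy
    exact hzmax (Metric.ball_subset_closedBall hy)
  have hI : ∀ i : Fin d, Integrable fun ξ : Rd d =>
      (((inner ℝ (EuclideanSpace.single i (1 : ℝ)) ξ : ℝ) ^ 2 : ℝ) : ℂ) * h ξ := by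
    intro i
    refine h2.mono ((Continuous.aestronglyMeasurable (by fun_prop)).mul hh.aestronglyMeasurable)
      (Eventually.of_forall fun ξ => ?_)
    rw [norm_mul, norm_mul, Complex.norm_real, Complex.norm_real, norm_pow, norm_pow, norm_norm]
    refine mul_le_mul_of_nonneg_right (pow_le_pow_left₀ (norm_nonneg _) ?_ 2) (norm_nonneg _)
    simpa using norm_inner_le_norm (𝕜 := ℝ) (EuclideanSpace.single i (1 : ℝ)) ξ
  -- At the interior maximum `z` the second differences of `φ` are nonpositive, and those of `ε|y|²`
  -- are exactly `2εt²` by the parallelogram law; so the second derivatives of `u` there are at most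
  -- `-2ε`.
  have hdir : ∀ i : Fin d, 2 * ε ≤ (synth (fun ξ =>
      (((inner ℝ (EuclideanSpace.single i (1 : ℝ)) ξ : ℝ) ^ 2 : ℝ) : ℂ) * h ξ) z).re := by
    intro i
    set e : Rd d := EuclideanSpace.single i (1 : ℝ) with he
    have hen : ‖e‖ = 1 := by simp [he]
    have h3 := (Complex.continuous_re.tendsto _).comp
      (tendsto_second_difference_synth hh z e (hI i))
    have h4 : -(synth (fun ξ => (((inner ℝ e ξ : ℝ) ^ 2 : ℝ) : ℂ) * h ξ) z).re ≤ -(2 * ε) := by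
      rw [← Complex.neg_re]
      refine le_of_tendsto h3 ?_
      have t1 : Tendsto (fun t : ℝ => z + t • e) (𝓝[≠] 0) (𝓝 z) := by
        refine tendsto_nhdsWithin_of_tendsto_nhds ?_
        have : Continuous fun t : ℝ => z + t • e := by fun_prop
        simpa using this.tendsto 0
      have t2 : Tendsto (fun t : ℝ => z - t • e) (𝓝[≠] 0) (𝓝 z) := by
        refine tendsto_nhdsWithin_of_tendsto_nhds ?_
        have : Continuous fun t : ℝ => z - t • e := by fun_prop
        simpa using this.tendsto 0
      filter_upwards [t1.eventually hloc, t2.eventually hloc, self_mem_nhdsWithin] with t a b ht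
      have ht2 : 0 < t ^ 2 := by
        have : t ≠ 0 := ht
        positivity
      have hp := parallelogram_law_with_norm ℝ z (t • e)
      simp only [norm_smul, hen, mul_one, Real.norm_eq_abs, sq_abs] at hp
      simp only [Function.comp, Complex.re_ofReal_mul, Complex.sub_re, Complex.add_re]
      have h5 : (2 * synth h z).re = 2 * u z := by simp [u]
      rw [h5, inv_mul_le_iff₀ ht2]
      change u (z + t • e) + u (z - t • e) - 2 * u z ≤ _
      simp only [φ] at a b
      nlinarith
    linarith
  have hsum : (synth (fun ξ => ((‖ξ‖ ^ 2 : ℝ) : ℂ) * h ξ) z).re = ∑ i : Fin d, (synth (fun ξ =>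
      (((inner ℝ (EuclideanSpace.single i (1 : ℝ)) ξ : ℝ) ^ 2 : ℝ) : ℂ) * h ξ) z).re := by
    rw [← Complex.re_sum]
    congr 1
    simp only [synth]
    rw [← integral_finsetSum _ fun i _ => integrable_character_mul (hI i) z]
    congr 1
    ext ξ
    rw [EuclideanSpace.real_norm_sq_eq, ← Finset.mul_sum, ← Finset.sum_mul]
    simp [EuclideanSpace.inner_single_left]
  -- Summing over the coordinates gives `2dε ≤ -Δu(z) ≤ 0`, a contradiction because `d ≥ 1`.
  have h6 : (d : ℝ) * (2 * ε) ≤ 0 := by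
    refine le_trans ?_ (hsub z huz)
    rw [hsum]
    simpa using Finset.card_nsmul_le_sum Finset.univ _ (2 * ε) fun i _ => hdir i
  have hd' : (1 : ℝ) ≤ d := by exact_mod_cast hd
  nlinarith

/-! ### The Barron space as a closed real subspace of `L¹`. -/

variable {s : ℝ}

theorem integrable_norm_mul_weight_iff {h : Rd d → ℂ} (hm : AEStronglyMeasurable h) :
    Integrable (fun ξ => ((weight s ξ : ℝ) : ℂ) * h ξ) ↔
      Integrable (fun ξ => ‖h ξ‖ * weight s ξ) := by
  have hc : Continuous fun ξ : Rd d => ((weight s ξ : ℝ) : ℂ) :=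
    Complex.continuous_ofReal.comp (continuous_weight s)
  have hwm : AEStronglyMeasurable fun ξ => ((weight s ξ : ℝ) : ℂ) * h ξ :=
    hc.aestronglyMeasurable.mul hm
  rw [← integrable_norm_iff hwm]
  refine integrable_congr (Eventually.of_forall fun ξ => ?_)
  simp only [norm_mul, Complex.norm_real, Real.norm_of_nonneg (weight_pos s ξ).le, mul_comm]

theorem unweight_weight_mul (h : Rd d → ℂ) :
    unweight s (fun ξ => ((weight s ξ : ℝ) : ℂ) * h ξ) = h := by
  ext ξ
  have : (weight s ξ : ℂ) ≠ 0 := by exact_mod_cast (weight_pos s ξ).ne'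
  rw [unweight]
  push_cast
  field_simp

theorem weight_mul_unweight (f : Rd d → ℂ) (ξ : Rd d) :
    ((weight s ξ : ℝ) : ℂ) * unweight s f ξ = f ξ := by
  have : (weight s ξ : ℂ) ≠ 0 := by exact_mod_cast (weight_pos s ξ).ne'
  rw [unweight]
  push_cast
  field_simp

/-- Multiplication of the transform by an even real function preserves real-valuedness. -/
theorem im_synth_mul_eq_zero {k : Rd d → ℂ} (hk : Integrable k)
    (h0 : ∀ x, (synth k x).im = 0) {m : Rd d → ℝ} (hm : ∀ ξ, m (-ξ) = m ξ) (x : Rd d) :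
    (synth (fun ξ => (m ξ : ℂ) * k ξ) x).im = 0 := by
  -- Real-valuedness of `synth k` is Hermitian symmetry of `k`, which an even real factor preserves.
  have e : k =ᵐ[volume] fun ξ => starRingEnd ℂ (k (-ξ)) := by
    refine ae_eq_of_synth_eq hk ?_ (funext fun y => ?_)
    · exact (Complex.conjCLE : ℂ →L[ℝ] ℂ).integrable_comp hk.comp_neg
    · rw [synth_conj_neg, Complex.conj_eq_iff_im.2 (h0 y)]
  have e' : (fun ξ => (m ξ : ℂ) * k ξ) =ᵐ[volume]
      fun ξ => starRingEnd ℂ ((fun ξ => (m ξ : ℂ) * k ξ) (-ξ)) := by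
    filter_upwards [e] with ξ hξ
    rw [map_mul, Complex.conj_ofReal, hm, ← hξ]
  rw [← Complex.conj_eq_iff_im, ← synth_conj_neg, ← synth_congr e']

/-- The integrable functions that are weighted transforms of real-valued functions. -/
def realSubmodule (d : ℕ) {s : ℝ} (hs : 0 ≤ s) :
    Submodule ℝ (Lp ℂ 1 (volume : Measure (Rd d))) where
  carrier := {f | ∀ x, (synth (unweight s f) x).im = 0}
  zero_mem' x := by
    obtain ⟨L, hL⟩ := exists_evaluation hs x
    rw [← hL, map_zero, Complex.zero_im]
  add_mem' {f g} hf hg x := by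
    obtain ⟨L, hL⟩ := exists_evaluation hs x
    rw [← hL, map_add, Complex.add_im, hL, hL, hf, hg, add_zero]
  smul_mem' c f hf x := by
    obtain ⟨L, hL⟩ := exists_evaluation hs x
    rw [← hL, L.map_smul_of_tower, Complex.smul_im, hL, hf, smul_zero]

/-- Point evaluations are continuous on `L¹`. Closedness gives completeness and lets compactness
pass to the restriction of `A`. -/
theorem isClosed_realSubmodule (hs : 0 ≤ s) :
    IsClosed (realSubmodule d hs : Set (Lp ℂ 1 (volume : Measure (Rd d)))) := by
  have : (realSubmodule d hs : Set (Lp ℂ 1 (volume : Measure (Rd d)))) =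
      ⋂ x : Rd d, {f : Lp ℂ 1 (volume : Measure (Rd d)) |
        (synth (unweight s f) x).im = 0} := by
    ext f
    simp only [Set.mem_iInter]
    rfl
  rw [this]
  refine isClosed_iInter fun x => ?_
  obtain ⟨L, hL⟩ := exists_evaluation (d := d) hs x
  simp only [← hL]
  exact isClosed_eq (by fun_prop) continuous_const

namespace BarronSpace

theorem integrable_weight_mul_hat (u : BarronSpace d s) :
    Integrable fun ξ => ((weight s ξ : ℝ) : ℂ) * hat u.toFn ξ :=
  (integrable_norm_mul_weight_iff u.hasFourier_hat.aestronglyMeasurable).2 u.integrable_hat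

theorem integrable_hat_of_nonneg (hs : 0 ≤ s) (u : BarronSpace d s) :
    Integrable (hat u.toFn) := by
  rw [← unweight_weight_mul (s := s) (hat u.toFn)]
  exact integrable_unweight hs u.integrable_weight_mul_hat

theorem toFn_ae_eq_synth (hs : 0 ≤ s) (u : BarronSpace d s) :
    (fun x => ((u.toFn x : ℝ) : ℂ)) =ᵐ[volume] synth (hat u.toFn) :=
  (hasFourier_iff_ae_eq_synth (u.integrable_hat_of_nonneg hs)).1 u.hasFourier_hat

/-- Almost everywhere equality of continuous functions is equality everywhere. -/
theorem im_synth_hat (hs : 0 ≤ s) (u : BarronSpace d s) (x : Rd d) :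
    (synth (hat u.toFn) x).im = 0 := by
  have hc := continuous_synth (u.integrable_hat_of_nonneg hs)
  have : (fun x => (synth (hat u.toFn) x).im) =ᵐ[volume] fun _ => 0 := by
    filter_upwards [u.toFn_ae_eq_synth hs] with y hy
    rw [← hy, Complex.ofReal_im]
  exact congrFun ((Complex.continuous_im.comp hc).ae_eq_iff_eq volume continuous_const |>.1 this) x

/-- The weighted transform of an element of the Barron space, in `L¹`. -/
def weightedHat (u : BarronSpace d s) : Lp ℂ 1 (volume : Measure (Rd d)) :=
  u.integrable_weight_mul_hat.toL1 _

theorem unweight_weightedHat (u : BarronSpace d s) :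
    unweight s u.weightedHat =ᵐ[volume] hat u.toFn := by
  have := unweight_ae_congr s u.integrable_weight_mul_hat.coeFn_toL1
  rwa [unweight_weight_mul] at this

theorem toFn_ae_eq_synth_weightedHat (hs : 0 ≤ s) (u : BarronSpace d s) :
    (fun x => ((u.toFn x : ℝ) : ℂ)) =ᵐ[volume] synth (unweight s u.weightedHat) := by
  rw [synth_congr u.unweight_weightedHat]
  exact u.toFn_ae_eq_synth hs

theorem weightedHat_mem (hs : 0 ≤ s) (u : BarronSpace d s) :
    u.weightedHat ∈ realSubmodule d hs := fun x => by
  rw [synth_congr u.unweight_weightedHat]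
  exact u.im_synth_hat hs x

/-- The weighted transform as a linear isometry. -/
def weightedHatₗᵢ (d : ℕ) {s : ℝ} (hs : 0 ≤ s) : BarronSpace d s →ₗᵢ[ℝ] realSubmodule d hs where
  toFun u := ⟨u.weightedHat, u.weightedHat_mem hs⟩
  map_add' u v := by
    refine Subtype.ext ?_
    change (u + v).weightedHat = u.weightedHat + v.weightedHat
    rw [weightedHat, weightedHat, weightedHat, ← Integrable.toL1_add]
    refine (Integrable.toL1_eq_toL1_iff _ _ _ _).2 ?_
    have := (u + v).hasFourier_hat.ae_unique
      (toFn_add u v ▸ u.hasFourier_hat.add v.hasFourier_hat)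
    filter_upwards [this] with ξ h
    simp only [h, Pi.add_apply, mul_add]
  map_smul' c u := by
    refine Subtype.ext ?_
    change (c • u).weightedHat = c • u.weightedHat
    rw [weightedHat, weightedHat, ← Integrable.toL1_smul]
    refine (Integrable.toL1_eq_toL1_iff _ _ _ _).2 ?_
    have := (c • u).hasFourier_hat.ae_unique (toFn_smul c u ▸ u.hasFourier_hat.smul c)
    filter_upwards [this] with ξ h
    simp only [h, Pi.smul_apply, Complex.real_smul, smul_eq_mul, mul_left_comm]
  norm_map' u := by
    change ‖u.weightedHat‖ = _
    rw [weightedHat, norm_toL1, norm_def]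
    simp only [norm_mul, Complex.norm_real, Real.norm_of_nonneg (weight_pos s _).le, mul_comm]

theorem surjective_weightedHatₗᵢ (hs : 0 ≤ s) : Function.Surjective (weightedHatₗᵢ d hs) := by
  rintro ⟨f, hf⟩
  have hi := integrable_unweight_Lp hs f
  have hc : Continuous fun x => (synth (unweight s f) x).re :=
    Complex.continuous_re.comp (continuous_synth hi)
  let g : Fn d := AEEqFun.mk _ hc.aestronglyMeasurable
  have hg : HasFourier g (unweight s f) := by
    refine (hasFourier_iff_ae_eq_synth hi).2 ?_
    filter_upwards [AEEqFun.coeFn_mk _ hc.aestronglyMeasurable] with x hx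
    rw [hx]
    exact Complex.ext (Complex.ofReal_re _) ((Complex.ofReal_im _).trans (hf x).symm)
  have hgm : MemBarron s g := by
    refine ⟨_, hg, (integrable_norm_mul_weight_iff hi.aestronglyMeasurable).1 ?_⟩
    simp only [weight_mul_unweight]
    exact L1.integrable_coeFn f
  let u : BarronSpace d s := ⟨g, hgm⟩
  refine ⟨u, Subtype.ext (Lp.ext ?_)⟩
  refine u.integrable_weight_mul_hat.coeFn_toL1.trans ?_
  filter_upwards [u.hasFourier_hat.ae_unique hg] with ξ h
  rw [h, weight_mul_unweight]

/-- The Barron space is isometric to a closed subspace of `L¹`. -/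
def equivRealSubmodule (d : ℕ) {s : ℝ} (hs : 0 ≤ s) : BarronSpace d s ≃ₗᵢ[ℝ] realSubmodule d hs :=
  LinearIsometryEquiv.ofSurjective (weightedHatₗᵢ d hs) (surjective_weightedHatₗᵢ hs)

theorem coe_equivRealSubmodule (hs : 0 ≤ s) (u : BarronSpace d s) :
    (equivRealSubmodule d hs u : Lp ℂ 1 (volume : Measure (Rd d))) = u.weightedHat := rfl

end BarronSpace

/-! ### Injectivity and the Fredholm alternative. -/

/-- If the transform `h` satisfies `(α + |ξ|²) h = - k`, where `synth k = w · synth h` with `w` real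
and `α + w ≥ 0`, then `Re (synth h) ≤ 0`. -/
theorem re_synth_nonpos_of_schrodinger (hd : 1 ≤ d) {α : ℝ} {h k : Rd d → ℂ} (hh : Integrable h)
    (hk : Integrable k) (e : ∀ᵐ ξ, ((α + ‖ξ‖ ^ 2 : ℝ) : ℂ) * h ξ = -k ξ) {w : Rd d → ℝ}
    (hw : ∀ x, 0 ≤ α + w x) (hkw : ∀ x, synth k x = w x * synth h x) (x : Rd d) :
    (synth h x).re ≤ 0 := by
  -- The transform of `-Δu = -(α + w) u`, whose right side is nonpositive where `u > 0`.
  have e' : (fun ξ => ((‖ξ‖ ^ 2 : ℝ) : ℂ) * h ξ) =ᵐ[volume]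
      fun ξ => (-1 : ℂ) * k ξ + (-α : ℂ) * h ξ := by
    filter_upwards [e] with ξ hξ
    push_cast at hξ ⊢
    linear_combination hξ
  have hi : Integrable fun ξ => (-1 : ℂ) * k ξ + (-α : ℂ) * h ξ :=
    (hk.const_mul _).add (hh.const_mul _)
  refine re_synth_nonpos hd hh (hi.congr e'.symm) (fun y hy => ?_) x
  rw [synth_congr e', synth_add (hk.const_mul _) (hh.const_mul _), synth_const_mul,
    synth_const_mul, hkw]
  have : (-1 : ℂ) * (w y * synth h y) + (-α : ℂ) * synth h y
      = ((-(α + w y) : ℝ) : ℂ) * synth h y := by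
    push_cast
    ring
  rw [this, Complex.re_ofReal_mul]
  have := mul_nonneg (hw y) hy.le
  linarith

/-- The equation is linear, so the one-sided bound applies to `h` and to `-h`. -/
theorem eq_zero_of_schrodinger (hd : 1 ≤ d) {α : ℝ} {h k : Rd d → ℂ} (hh : Integrable h)
    (hk : Integrable k) (e : ∀ᵐ ξ, ((α + ‖ξ‖ ^ 2 : ℝ) : ℂ) * h ξ = -k ξ) {w : Rd d → ℝ}
    (hw : ∀ x, 0 ≤ α + w x) (hkw : ∀ x, synth k x = w x * synth h x)
    (hre : ∀ x, (synth h x).im = 0) : h =ᵐ[volume] 0 := by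
  refine ae_eq_of_synth_eq hh (integrable_zero _ _ _) (funext fun x => ?_)
  have h1 := re_synth_nonpos_of_schrodinger hd hh hk e hw hkw x
  have h2 := re_synth_nonpos_of_schrodinger hd (hh.const_mul (-1)) (hk.const_mul (-1)) (by
    filter_upwards [e] with ξ hξ
    linear_combination -hξ) hw (fun y => by
    rw [synth_const_mul, synth_const_mul, hkw]
    ring) x
  rw [synth_const_mul, neg_one_mul, Complex.neg_re] at h2
  have h3 : synth (0 : Rd d → ℂ) x = 0 := by simp [synth]
  rw [h3]
  exact Complex.ext (by simp only [Complex.zero_re]; linarith) (hre x)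

/-- The Fredholm alternative: `1 + A` is invertible if `A` is compact and `1 + A` injective. -/
theorem isUnit_one_add_of_isCompactOperator {E : Type*} [NormedAddCommGroup E] [NormedSpace ℝ E]
    [CompleteSpace E] {A : E →L[ℝ] E} (hA : IsCompactOperator A)
    (h0 : ∀ f, A f = -f → f = 0) : IsUnit (1 + A) := by
  rcases hA.hasEigenvalue_or_mem_resolventSet (μ := (-1 : ℝ)) (by norm_num) with h | h
  · obtain ⟨f, hf⟩ := h.exists_hasEigenvector
    refine absurd (h0 f ?_) hf.2
    have := hf.apply_eq_smul
    simpa using this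
  · rw [spectrum.mem_resolventSet_iff, map_neg, map_one] at h
    rw [← IsUnit.neg_iff, neg_add]
    rwa [sub_eq_add_neg] at h

end Barron

end

/-! ### Transfer back to the Barron space. -/

theorem proposition3p2 (d : ℕ) (hd : 1 ≤ d) (s : ℝ) (hs : 0 ≤ s)
    (V : Barron.Rd d → ℝ) (hV : ∀ x, 0 ≤ V x)
    (α : ℝ) (hα : 0 < α) (W : Barron.BarronSpace d s)
    (hVW : V =ᵐ[volume] fun x => α + W.toFn x) :
    ∃ T : Barron.BarronSpace d s →L[ℝ] Barron.BarronSpace d s,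
      (∀ u, Barron.SolvesHelmholtz α (W.toFn * u.toFn) (T u).toFn ∧
        (T u).toFn = Barron.schrodingerOp α W.toFn u.toFn) ∧
      ∃ S : Barron.BarronSpace d s →L[ℝ] Barron.BarronSpace d s,
        S ∘L (ContinuousLinearMap.id ℝ _ + T) = ContinuousLinearMap.id ℝ _ ∧
        (ContinuousLinearMap.id ℝ _ + T) ∘L S = ContinuousLinearMap.id ℝ _ := by
  open Barron Filter in
  obtain ⟨P, A, hAc, hAP, hP⟩ := exists_schrodinger_operators hs hα W.integrable_weight_mul_hat
  have hpos : ∀ ξ : Rd d, 0 < α + ‖ξ‖ ^ 2 := fun ξ => by positivity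
  let w : Rd d → ℝ := fun x => (synth (hat W.toFn) x).re
  have hw : ∀ x, synth (hat W.toFn) x = w x := fun x =>
    (Complex.ext (Complex.ofReal_re _) (by rw [W.im_synth_hat hs, Complex.ofReal_im])).symm
  have hwc : Continuous w :=
    Complex.continuous_re.comp (continuous_synth (W.integrable_hat_of_nonneg hs))
  have hw0 : ∀ x, 0 ≤ α + w x := by
    -- `V = α + W` holds only almost everywhere, but the maximum principle needs a pointwise sign;
    -- continuity of `w` upgrades this equality to every point.
    have h1 : (fun x => α + w x) =ᵐ[volume] fun x => |α + w x| := by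
      filter_upwards [hVW, W.toFn_ae_eq_synth hs] with x h2 h3
      have h4 : W.toFn x = w x := by exact_mod_cast h3.trans (hw x)
      rw [← h4, ← h2, abs_of_nonneg (hV x)]
    have h2 := (Continuous.ae_eq_iff_eq volume (by fun_prop) (by fun_prop)).1 h1
    exact fun x => (abs_nonneg _).trans_eq (congrFun h2 x).symm
  -- `W u` is real when `u` is, and the symbol `1/(α + |ξ|²)` is real and even.
  have hreal : ∀ f ∈ realSubmodule d hs, A f ∈ realSubmodule d hs := by
    intro f hf x
    have e : unweight s (A f) =ᵐ[volume]
        fun ξ => (((α + ‖ξ‖ ^ 2)⁻¹ : ℝ) : ℂ) * unweight s (P f) ξ := by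
      refine (unweight_ae_congr s (hAP f)).trans (Eventually.of_forall fun ξ => ?_)
      simp only [unweight]
      ring
    rw [synth_congr e]
    refine im_synth_mul_eq_zero (integrable_unweight_Lp hs _) (fun y => ?_)
      (m := fun ξ => (α + ‖ξ‖ ^ 2)⁻¹) (fun ξ => by rw [norm_neg]) x
    rw [hP, hw, Complex.im_ofReal_mul, hf y, mul_zero]
  have hsymbol : ∀ f, ∀ᵐ ξ, ((α + ‖ξ‖ ^ 2 : ℝ) : ℂ) * unweight s (A f) ξ = unweight s (P f) ξ := by
    intro f
    filter_upwards [unweight_ae_congr s (hAP f)] with ξ h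
    have h1 : ((α + ‖ξ‖ ^ 2 : ℝ) : ℂ) ≠ 0 := by exact_mod_cast (hpos ξ).ne'
    rw [h, unweight, unweight, mul_left_comm, Complex.ofReal_inv (α + ‖ξ‖ ^ 2),
      mul_inv_cancel_left₀ h1]
  let A' : realSubmodule d hs →L[ℝ] realSubmodule d hs :=
    ((A.restrictScalars ℝ).comp (realSubmodule d hs).subtypeL).codRestrict _
      fun f => hreal f f.2
  have hA'c : IsCompactOperator A' :=
    IsCompactOperator.codRestrict (hAc.comp_clm (realSubmodule d hs).subtypeL)
      (fun f => hreal f f.2) (isClosed_realSubmodule hs)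
  have hinj : ∀ f, A' f = -f → f = 0 := by
    rintro ⟨f, hf⟩ h
    have h1 : A f = -f := congrArg Subtype.val h
    refine Subtype.ext (Lp.ext ?_)
    have h2 : unweight s (A f) =ᵐ[volume] fun ξ => -unweight s f ξ := by
      rw [h1]
      refine (unweight_ae_congr s (Lp.coeFn_neg f)).trans (Eventually.of_forall fun ξ => ?_)
      simp [unweight]
    have h3 : unweight s f =ᵐ[volume] 0 := by
      refine eq_zero_of_schrodinger hd (integrable_unweight_Lp hs f)
        (integrable_unweight_Lp hs (P f)) ?_ hw0 (fun x => by rw [hP, hw]) hf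
      filter_upwards [hsymbol f, h2] with ξ h3 h4
      rw [← h3, h4, mul_neg, neg_neg]
    filter_upwards [h3, Lp.coeFn_zero ℂ 1 (volume : Measure (Rd d))] with ξ h4 h5
    rw [← weight_mul_unweight (s := s) f ξ, h4]
    exact (mul_zero _).trans h5.symm
  have : CompleteSpace (realSubmodule d hs) := (isClosed_realSubmodule hs).completeSpace_coe
  obtain ⟨S', h1, h2⟩ := isUnit_iff_exists.1 (isUnit_one_add_of_isCompactOperator hA'c hinj)
  let e := (BarronSpace.equivRealSubmodule d hs).toContinuousLinearEquiv
  refine ⟨e.symm ∘L A' ∘L e, fun u => ?_, e.symm ∘L S' ∘L e, ?_, ?_⟩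
  · have hT : ((e.symm ∘L A' ∘L e : BarronSpace d s →L[ℝ] BarronSpace d s) u).weightedHat
        = A u.weightedHat := by
      rw [← BarronSpace.coe_equivRealSubmodule hs]
      exact congrArg Subtype.val (e.apply_symm_apply (A' (e u)))
    generalize (e.symm ∘L A' ∘L e : BarronSpace d s →L[ℝ] BarronSpace d s) u = v at hT ⊢
    have hsol : SolvesHelmholtz α (W.toFn * u.toFn) v.toFn := by
      refine solvesHelmholtz_of_synth (integrable_unweight_Lp hs (A u.weightedHat))
        (integrable_unweight_Lp hs (P u.weightedHat)) (hsymbol _) ?_ ?_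
      · rw [← hT]
        exact v.toFn_ae_eq_synth_weightedHat hs
      · filter_upwards [AEEqFun.coeFn_mul W.toFn u.toFn, W.toFn_ae_eq_synth hs,
          u.toFn_ae_eq_synth_weightedHat hs] with x h3 h4 h5
        rw [h3, hP, ← h4, ← h5, Pi.mul_apply, Complex.ofReal_mul]
    exact ⟨hsol, hsol.eq_helmholtzInv hα⟩
  · ext1 u
    have := congrArg (fun B : realSubmodule d hs →L[ℝ] realSubmodule d hs => e.symm (B (e u))) h2
    simpa using this
  · ext1 u
    have := congrArg (fun B : realSubmodule d hs →L[ℝ] realSubmodule d hs => e.symm (B (e u))) h1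
    simpa using this
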